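/- Let $\Bbbk$ be an algebraically closed field of characteristic $0$, $\mathfrak g$ a finite-dimensional semisimple Lie algebra over $\Bbbk$, $\mathfrak h$ a Cartan subalgebra of $\mathfrak g$, $R$ the root system of $(\mathfrak g,\mathfrak h)$, $\mathfrak g^\alpha$ the root space of $\alpha\in R$, and $\Pi$ a base of $R$. For $S\subseteq\Pi$ put $R^S=R\cap\mathbb ZS$, $R^S_+=R\cap\mathbb NS$ and $R^S_-=R^S\setminus R^S_+=-R^S_+$; if $S$ is (non-empty and) connected in the Dynkin diagram, let $\varepsilon_S$ be the highest root of the irreducible root system $R^S$ relative to its base $S$. Define sets $\mathcal K(S)$ of subsets of $S$ by recursion on the cardinality of $S$: $\mathcal K(\emptyset)=\emptyset$; $\mathcal K(S)=\mathcal K(S_1)\cup\dots\cup\mathcal K(S_r)$ if $S_1,\dots,S_r$ are the connected components of $S$; and $\mathcal K(S)=\{S\}\cup\mathcal K(\{\alpha\in S:\langle\alpha,\varepsilon_S^\vee\rangle=0\})$ if $S$ is connected. For $S,T\subseteq\Pi$ let $E_{S,T}\subseteq\mathfrak h^*$ be the linear span of the $\varepsilon_K$ with $K\in\mathcal K(S)\cup\mathcal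 K(T)$, and put $$\mathfrak g_{S,T}=\mathfrak h\oplus\bigoplus_{\alpha\in R^S_+}\mathfrak g^\alpha\oplus\bigoplus_{\alpha\in R^T_-}\mathfrak g^\alpha,$$ $$d_{S,T}=\dim\mathfrak h+\operatorname{card}\mathcal K(S)+\operatorname{card}\mathcal K(T)-2\dim E_{S,T}.$$ Here $\mathfrak g_{S,T}$ is a Lie subalgebra of $\mathfrak g$. The index of a finite-dimensional Lie algebra $\mathfrak a$ is $\chi(\mathfrak a)=\min_{f\in\mathfrak a^*}\dim\mathfrak a^{(f)}$, where $\mathfrak a^{(f)}=\{X\in\mathfrak a: f([X,Y])=0\text{ for all }Y\in\mathfrak a\}$. **Proposition 4.2.** Let $S,T\subseteq\Pi$. If $d_{S,T}\in\{0,1\}$, then $\chi(\mathfrak g_{S,T})=d_{S,T}$. -/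

import Mathlib

open Module

noncomputable section

namespace RootPairing.Base

variable {ι R M N : Type*} [CommRing R] [AddCommGroup M] [Module R M] [AddCommGroup N] [Module R N]
  {P : RootPairing ι R M N} (b : P.Base)

/-- `ℕS`: the combinations with non-negative integer coefficients of the elements of a set `S` of
simple roots. -/
def natSpan (S : Set b.support) : AddSubmonoid M :=
  AddSubmonoid.closure ((fun a : b.support ↦ P.root a) '' S)

/-- `ℤS`: the combinations with integer coefficients of the elements of `S`. -/
def intSpan (S : Set b.support) : AddSubgroup M :=
  AddSubgroup.closure ((fun a : b.support ↦ P.root a) '' S)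

/-- `R^S = R ∩ ℤS` (as a set of indices of roots). -/
def rootsOf (S : Set b.support) : Set ι := {i | P.root i ∈ b.intSpan S}

/-- `R^S_+ = R ∩ ℕS`. -/
def posRoots (S : Set b.support) : Set ι := {i | P.root i ∈ b.natSpan S}

/-- `R^S_- = -R^S_+`. -/
def negRoots (S : Set b.support) : Set ι := {i | -P.root i ∈ b.natSpan S}

/-- The graph underlying the Dynkin diagram: two distinct simple roots are joined
when they are not orthogonal. -/
def dynkinGraph : SimpleGraph b.support :=
  SimpleGraph.fromRel fun a c ↦ P.pairing a c ≠ 0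

/-- `S` is a (non-empty) connected set of simple roots. -/
def IsConn (S : Set b.support) : Prop := (b.dynkinGraph.induce S).Connected

/-- `C` is a connected component of `S`. -/
def IsComponent (S C : Set b.support) : Prop :=
  Maximal (fun C' : Set b.support ↦ C' ⊆ S ∧ b.IsConn C') C

/-- `e` is (the index of) the greatest root `ε_S` of `R^S` relative to `S`, for the order in which
`β ≤ γ` means `γ - β ∈ ℕS`. -/
def IsHighestRoot (S : Set b.support) (e : ι) : Prop :=
  e ∈ b.rootsOf S ∧ ∀ i ∈ b.rootsOf S, P.root e - P.root i ∈ b.natSpan S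

/-- `b.InCascade S K` means `K ∈ 𝒦(S)`. The set `𝒦(S)` is given by the recursion
`𝒦(∅) = ∅`; `𝒦(S)` is the union of the `𝒦(C)` for `C` a connected component of `S`; and
`𝒦(S) = {S} ∪ 𝒦({α ∈ S | ⟨α, ε_S^∨⟩ = 0})` if `S` is connected. -/
inductive InCascade : Set b.support → Set b.support → Prop
  | component {S C K : Set b.support} (hC : b.IsComponent S C) (hK : InCascade C K) :
      InCascade S K
  | self {S : Set b.support} (hS : b.IsConn S) : InCascade S S
  | orthogonal {S K : Set b.support} {e : ι} (hS : b.IsConn S) (he : b.IsHighestRoot S e)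
      (hK : InCascade {a ∈ S | P.pairing a e = 0} K) : InCascade S K

/-- The set `𝒦(S)`. -/
def cascade (S : Set b.support) : Set (Set b.support) := {K | b.InCascade S K}

/-- The subspace `E_{S,T}` spanned by the highest roots `ε_K`, for `K ∈ 𝒦(S) ∪ 𝒦(T)`. -/
def cascadeSpan (S T : Set b.support) : Submodule R M :=
  Submodule.span R {x | ∃ K ∈ b.cascade S ∪ b.cascade T, ∃ e, b.IsHighestRoot K e ∧ x = P.root e}

/-- A sum of two elements of `ℕΠ` lies in `ℕS` only if both summands do. -/
lemma mem_natSpan_of_add_mem [CharZero R] {S : Set b.support} {x y : M}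
    (hx : x ∈ b.natSpan Set.univ) (hy : y ∈ b.natSpan Set.univ) (h : x + y ∈ b.natSpan S) :
    x ∈ b.natSpan S := by
  classical
  have key : ∀ (U : Set b.support) (z : M), z ∈ b.natSpan U →
      ∃ f : b.support → ℕ, (∀ a ∉ U, f a = 0) ∧ z = ∑ a, f a • P.root a := by
    intro U z hz
    refine AddSubmonoid.closure_induction ?_ ⟨0, by simp⟩ ?_ hz
    · rintro - ⟨a, ha, rfl⟩
      refine ⟨Pi.single a 1, fun c hc ↦ ?_, ?_⟩
      · exact Pi.single_eq_of_ne (by rintro rfl; exact hc ha) _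
      · simp [Pi.single_apply, ite_smul]
    · rintro _ _ _ _ ⟨f, hf, rfl⟩ ⟨g, hg, rfl⟩
      exact ⟨f + g, fun a ha ↦ by simp [hf a ha, hg a ha],
        by simp [add_smul, Finset.sum_add_distrib]⟩
  obtain ⟨f, -, rfl⟩ := key _ _ hx
  obtain ⟨g, -, rfl⟩ := key _ _ hy
  obtain ⟨k, hk, e⟩ := key _ _ h
  have hli : LinearIndependent ℕ (fun a : b.support ↦ P.root a) :=
    b.linearIndepOn_root.restrict_scalars' ℕ
  have hfg := Fintype.linearIndependent_iffₛ.mp hli (f + g) k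
    (by simpa [add_smul, Finset.sum_add_distrib] using e)
  refine sum_mem fun a _ ↦ ?_
  by_cases ha : a ∈ S
  · have hm : P.root a ∈ b.natSpan S := AddSubmonoid.subset_closure ⟨a, ha, rfl⟩
    exact nsmul_mem hm _
  · have h0 : f a = 0 := by
      have := hfg a
      simp only [Pi.add_apply, hk a ha] at this
      omega
    simp [h0]

/-- `R^S_+ ∪ R^T_-` is a closed set of roots. -/
lemma closed_posRoots_union_negRoots [CharZero R] {S T : Set b.support} {i j k : ι}
    (hi : i ∈ b.posRoots S ∪ b.negRoots T) (hj : j ∈ b.posRoots S ∪ b.negRoots T)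
    (hk : P.root k = P.root i + P.root j) : k ∈ b.posRoots S ∪ b.negRoots T := by
  have mono : ∀ (U : Set b.support) (z : M), z ∈ b.natSpan U → z ∈ b.natSpan Set.univ :=
    fun U z hz ↦ AddSubmonoid.closure_mono (Set.image_mono (Set.subset_univ U)) hz
  have himg : (fun a : b.support ↦ P.root a) '' Set.univ = P.root '' (b.support : Set ι) := by
    ext z; simp
  have hpn : P.root k ∈ b.natSpan Set.univ ∨ -P.root k ∈ b.natSpan Set.univ := by
    simpa only [natSpan, himg] using b.root_mem_or_neg_mem k
  have mixed : ∀ i j : ι, P.root i ∈ b.natSpan S → -P.root j ∈ b.natSpan T →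
      P.root k = P.root i + P.root j → k ∈ b.posRoots S ∪ b.negRoots T := by
    intro i j hi hj hk
    rcases hpn with h | h
    · exact Or.inl (b.mem_natSpan_of_add_mem h (mono _ _ hj) (by simpa [hk] using hi))
    · exact Or.inr (b.mem_natSpan_of_add_mem h (mono _ _ hi) (by simpa [hk] using hj))
  rcases hi with hi | hi <;> rcases hj with hj | hj
  · left
    change P.root k ∈ b.natSpan S
    rw [hk]
    exact add_mem hi hj
  · exact mixed i j hi hj hk
  · exact mixed j i hj hi (by rw [hk, add_comm])
  · right
    change -P.root k ∈ b.natSpan T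
    rw [hk, neg_add]
    exact add_mem hi hj

end RootPairing.Base

namespace LieAlgebra

/-- The alternating bilinear form `Φ_f(X, Y) = f([X, Y])` attached to a linear form `f`. -/
def kirillovForm {K A : Type*} [CommRing K] [LieRing A] [LieAlgebra K A] (f : Dual K A) :
    LinearMap.BilinForm K A :=
  (LieModule.toEnd K A A : A →ₗ[K] Module.End K A).compr₂ f

/-- The index `χ(A) = inf {dim A^(f) | f ∈ A^*}`, where `A^(f)` is the kernel of `Φ_f`. -/
def index (K A : Type*) [Field K] [LieRing A] [LieAlgebra K A] : ℕ :=
  ⨅ f : Dual K A, finrank K (LinearMap.ker (kirillovForm f))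

open LieAlgebra.IsKilling LieModule

variable {K L : Type*} [Field K] [CharZero K] [IsAlgClosed K] [LieRing L] [LieAlgebra K L]
  [FiniteDimensional K L] [LieAlgebra.IsSemisimple K L]
  {H : LieSubalgebra K L} [H.IsCartanSubalgebra]

/-- The standard special (seaweed, biparabolic) subalgebra
`𝔤_{S,T} = 𝔥 ⊕ ∑_{α ∈ R^S_+} 𝔤^α ⊕ ∑_{α ∈ R^T_-} 𝔤^α`. -/
def seaweed (b : (rootSystem H).Base) (S T : Set b.support) : LieSubalgebra K L where
  toSubmodule := H.toSubmodule ⊔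
    (⨆ α ∈ b.posRoots S, (rootSpace H α.1).toSubmodule) ⊔
    (⨆ α ∈ b.negRoots T, (rootSpace H α.1).toSubmodule)
  lie_mem' := by
    set Q : Submodule K L := H.toSubmodule ⊔
      (⨆ α ∈ b.posRoots S, (rootSpace H α.1).toSubmodule) ⊔
      (⨆ α ∈ b.negRoots T, (rootSpace H α.1).toSubmodule) with hQ
    let W : Set (H → K) :=
      {χ | χ = 0 ∨ ∃ α ∈ b.posRoots S ∪ b.negRoots T, χ = (α.1 : H → K)}
    have hH : H.toSubmodule = (rootSpace H (0 : H → K)).toSubmodule := by simp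
    have hle : ∀ χ ∈ W, (rootSpace H χ).toSubmodule ≤ Q := by
      rintro χ (rfl | ⟨α, hα | hα, rfl⟩)
      · rw [← hH]
        exact le_sup_left.trans le_sup_left
      · exact (le_iSup₂ (f := fun (α : H.root) (_ : α ∈ b.posRoots S) ↦
          (rootSpace H α.1).toSubmodule) α hα).trans (le_sup_right.trans le_sup_left)
      · exact (le_iSup₂ (f := fun (α : H.root) (_ : α ∈ b.negRoots T) ↦
          (rootSpace H α.1).toSubmodule) α hα).trans le_sup_right
    have hQW : Q = ⨆ χ ∈ W, (rootSpace H χ).toSubmodule := by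
      refine le_antisymm (sup_le (sup_le ?_ ?_) ?_) (iSup₂_le hle)
      · rw [hH]
        exact le_iSup₂_of_le (0 : H → K) (Or.inl rfl) le_rfl
      · exact iSup₂_le fun α hα ↦
          le_iSup₂_of_le (α.1 : H → K) (Or.inr ⟨α, Or.inl hα, rfl⟩) le_rfl
      · exact iSup₂_le fun α hα ↦
          le_iSup₂_of_le (α.1 : H → K) (Or.inr ⟨α, Or.inr hα, rfl⟩) le_rfl
    have hadd : ∀ χ ∈ W, ∀ ψ ∈ W, (rootSpace H (χ + ψ)).toSubmodule ≤ Q := by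
      intro χ hχ ψ hψ
      by_cases hbot : rootSpace H (χ + ψ) = ⊥
      · simp [hbot]
      refine hle _ ?_
      rcases hχ with rfl | ⟨α, hα, rfl⟩
      · simpa using hψ
      rcases hψ with rfl | ⟨β, hβ, rfl⟩
      · exact Or.inr ⟨α, hα, by simp⟩
      by_cases h0 : (α.1 + β.1 : H → K) = 0
      · exact Or.inl h0
      let γ : Weight K H L := ⟨α.1 + β.1, hbot⟩
      have hγ : γ ∈ H.root := by
        have hnz : γ.IsNonZero := h0
        simpa [LieSubalgebra.root] using hnz
      refine Or.inr ⟨⟨γ, hγ⟩, b.closed_posRoots_union_negRoots hα hβ ?_, rfl⟩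
      ext x
      rfl
    intro x y hx hy
    change x ∈ Q at hx
    change y ∈ Q at hy
    change ⁅x, y⁆ ∈ Q
    rw [hQW] at hx hy
    induction hx using Submodule.iSup_induction' with
    | zero => simp
    | add u v _ _ hu hv => rw [add_lie]; exact add_mem hu hv
    | mem χ u hu =>
      by_cases hχ : χ ∈ W
      swap
      · obtain rfl : u = 0 := by simpa [hχ] using hu
        simp
      simp only [hχ, iSup_pos] at hu
      induction hy using Submodule.iSup_induction' with
      | zero => simp
      | add v w _ _ hv hw => rw [lie_add]; exact add_mem hv hw
      | mem ψ v hv =>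
        by_cases hψ : ψ ∈ W
        swap
        · obtain rfl : v = 0 := by simpa [hψ] using hv
          simp
        simp only [hψ, iSup_pos] at hv
        exact hadd χ hχ ψ hψ (lie_mem_genWeightSpace_of_mem_genWeightSpace hu hv)

/-- `d_{S,T} = rg 𝔤 + card 𝒦(S) + card 𝒦(T) - 2 dim E_{S,T}`, where the rank `rg 𝔤` is the
dimension of the Cartan subalgebra `𝔥`. -/
def seaweedBound (b : (rootSystem H).Base) (S T : Set b.support) : ℤ :=
  finrank K H + (b.cascade S).ncard + (b.cascade T).ncard - 2 * finrank K (b.cascadeSpan S T)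

end LieAlgebra

end

set_option linter.unusedSectionVars false

noncomputable section

namespace RootPairing.Base

/-! ### The cones `ℕS` and the signs of pairings on them. -/

section Cone

variable {ι K M N : Type*} [Field K] [CharZero K] [AddCommGroup M] [Module K M]
  [AddCommGroup N] [Module K N] {P : RootPairing ι K M N} (b : P.Base)

/-! For all `S` and `T`, the index of `𝔤_{S,T}` is at most `d` (`index_seaweed_le`) and congruent to
`d` modulo 2 (`index_seaweed_modEq`). Being a natural number, it equals `d` when `d` is 0 or 1.

Both facts rest on the structure of the cascade. Every `α ∈ R^S_+` belongs to exactly one `K ∈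
𝒦(S)`, the one with `α ∈ R^K_+` and `⟨α, ε_K^∨⟩ > 0`; if `α ≠ ε_K`, then `ε_K - α` is another root
of the same class. So `α ↦ ε_K - α` is an involution off the `ε_K` without fixed points, and `card
R^S_+ ≡ card 𝒦(S)` mod 2. Since alternating forms have even rank, the index has the parity of `dim
𝔤_{S,T}`, which is that of `d`.

For the upper bound, take a form `f` supported on the root spaces of `ε_K` (`K ∈ 𝒦(S)`) and `-ε_K`
(`K ∈ 𝒦(T)`), the "tops". Besides the pairs inside one class, its matrix has unwanted entries from a
positive and a negative root whose sum is a top. They are removed by degeneration: give a top `γ`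
the coefficient `t^(-2 size γ)`, a top root vector the factor `t^(2 size γ)`, any other root vector
the factor `t^(size)` of its top, and `𝔥` the factor 1. Since `size` grows fast with the support,
the resulting matrix is polynomial in `t`, and at `t = 0` only the wanted entries remain
(`two_mul_size_lt_or_top_eq`). The kernel of the limit embeds in the product of the annihilator of
`E_{S,T}` in `𝔥` and the space of linear relations among the tops, of dimensions `dim 𝔥 - dim E` and
`card 𝒦(S) + card 𝒦(T) - dim E`, with total `d`. Kernels do not grow on passing from `t = 0` to a
general `t` (`Matrix.exists_ne_zero_finrank_ker_le`). -/

lemma natSpan_mono {S T : Set b.support} (h : S ⊆ T) : b.natSpan S ≤ b.natSpan T :=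
  AddSubmonoid.closure_mono (Set.image_mono h)

lemma mem_natSpan_univ {S : Set b.support} {x : M} (h : x ∈ b.natSpan S) :
    x ∈ b.natSpan Set.univ :=
  b.natSpan_mono (Set.subset_univ S) h

lemma root_mem_natSpan {S : Set b.support} {a : b.support} (ha : a ∈ S) :
    P.root a ∈ b.natSpan S :=
  AddSubmonoid.subset_closure ⟨a, ha, rfl⟩

lemma natSpan_le_intSpan (S : Set b.support) : b.natSpan S ≤ (b.intSpan S).toAddSubmonoid :=
  (AddSubmonoid.closure_le).mpr AddSubgroup.subset_closure

lemma root_mem_natSpan_univ_or_neg (i : ι) :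
    P.root i ∈ b.natSpan Set.univ ∨ -P.root i ∈ b.natSpan Set.univ := by
  have himg : (fun a : b.support ↦ P.root a) '' Set.univ = P.root '' (b.support : Set ι) := by
    ext z; simp
  simpa only [natSpan, himg] using b.root_mem_or_neg_mem i

lemma eq_zero_of_mem_natSpan_empty {x : M} (h : x ∈ b.natSpan ∅) : x = 0 := by
  simpa [natSpan] using h

lemma eq_zero_of_mem_natSpan_of_neg_mem {x : M} (h : x ∈ b.natSpan Set.univ)
    (h' : -x ∈ b.natSpan Set.univ) : x = 0 :=
  b.eq_zero_of_mem_natSpan_empty <|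
    b.mem_natSpan_of_add_mem h h' (by rw [add_neg_cancel]; exact zero_mem _)

lemma root_mem_natSpan_iff {S : Set b.support} {a : b.support} :
    P.root a ∈ b.natSpan S ↔ a ∈ S := by
  refine ⟨fun h ↦ ?_, b.root_mem_natSpan⟩
  by_contra ha
  have hli : LinearIndependent K (fun a : b.support ↦ P.root a) := b.linearIndepOn_root
  refine hli.notMem_span_image ha ?_
  have : b.natSpan S ≤ (Submodule.span K ((fun a : b.support ↦ P.root a) '' S)).toAddSubmonoid :=
    AddSubmonoid.closure_le.mpr Submodule.subset_span
  exact this h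

lemma mem_natSpan_inter {S T : Set b.support} {x : M} (hS : x ∈ b.natSpan S)
    (hT : x ∈ b.natSpan T) : x ∈ b.natSpan (S ∩ T) := by
  induction hS using AddSubmonoid.closure_induction with
  | mem x hx =>
    obtain ⟨a, ha, rfl⟩ := hx
    exact b.root_mem_natSpan ⟨ha, b.root_mem_natSpan_iff.mp hT⟩
  | zero => exact zero_mem _
  | add x y hx hy ihx ihy =>
    have hx' := b.mem_natSpan_univ hx
    have hy' := b.mem_natSpan_univ hy
    exact add_mem (ihx (b.mem_natSpan_of_add_mem hx' hy' hT))
      (ihy (b.mem_natSpan_of_add_mem hy' hx' (by rwa [add_comm])))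

/-- If `a ≤ x` and `x ∈ ℕS` then `a ∈ S`. -/
lemma mem_of_sub_mem_natSpan {S : Set b.support} {a : b.support} {x : M} (hx : x ∈ b.natSpan S)
    (h : x - P.root a ∈ b.natSpan Set.univ) : a ∈ S :=
  b.root_mem_natSpan_iff.mp <|
    b.mem_natSpan_of_add_mem (b.root_mem_natSpan (Set.mem_univ a)) h (by simpa)

lemma sub_mem_natSpan_of_mem {S : Set b.support} {x y : M} (hx : x ∈ b.natSpan S)
    (hy : y ∈ b.natSpan Set.univ) (h : x - y ∈ b.natSpan Set.univ) : x - y ∈ b.natSpan S :=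
  b.mem_natSpan_of_add_mem h hy (by simpa)

/-- An element of `ℕS` is a combination of the simple roots below it. -/
lemma mem_natSpan_support {S : Set b.support} {x : M} (hx : x ∈ b.natSpan S) :
    x ∈ b.natSpan {a ∈ S | x - P.root a ∈ b.natSpan S} := by
  induction hx using AddSubmonoid.closure_induction with
  | mem x hx =>
    obtain ⟨a, ha, rfl⟩ := hx
    exact b.root_mem_natSpan ⟨ha, by simp⟩
  | zero => exact zero_mem _
  | add x y hx hy ihx ihy =>
    refine add_mem (b.natSpan_mono ?_ ihx) (b.natSpan_mono ?_ ihy)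
    · rintro a ⟨ha, h⟩
      exact ⟨ha, by rw [add_sub_right_comm]; exact add_mem h hy⟩
    · rintro a ⟨ha, h⟩
      exact ⟨ha, by rw [add_sub_assoc]; exact add_mem hx h⟩

lemma posRoots_subset_rootsOf (S : Set b.support) : b.posRoots S ⊆ b.rootsOf S :=
  fun _ h ↦ b.natSpan_le_intSpan S h

/-- Write the root as `y - z` with `y, z ∈ ℕS`. If it lies in `ℕΠ`, its sum with `z` is in `ℕS`, so
it is too; the negative case is symmetric. -/
lemma mem_posRoots_or_neg_of_mem_rootsOf {S : Set b.support} {i : ι} (hi : i ∈ b.rootsOf S) :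
    i ∈ b.posRoots S ∨ -P.root i ∈ b.natSpan S := by
  have key : ∀ x ∈ b.intSpan S, ∃ y ∈ b.natSpan S, ∃ z ∈ b.natSpan S, x = y - z := by
    intro x hx
    induction hx using AddSubgroup.closure_induction with
    | mem x hx => exact ⟨x, AddSubmonoid.subset_closure hx, 0, zero_mem _, by simp⟩
    | zero => exact ⟨0, zero_mem _, 0, zero_mem _, by simp⟩
    | add x y _ _ hx hy =>
      obtain ⟨u, hu, v, hv, rfl⟩ := hx
      obtain ⟨u', hu', v', hv', rfl⟩ := hy
      exact ⟨u + u', add_mem hu hu', v + v', add_mem hv hv', by abel⟩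
    | neg x _ hx =>
      obtain ⟨u, hu, v, hv, rfl⟩ := hx
      exact ⟨v, hv, u, hu, by abel⟩
  obtain ⟨y, hy, z, hz, h⟩ := key _ hi
  rcases b.root_mem_natSpan_univ_or_neg i with h' | h'
  · exact Or.inl (b.mem_natSpan_of_add_mem h' (b.mem_natSpan_univ hz) (by simpa [h]))
  · exact Or.inr (b.mem_natSpan_of_add_mem h' (b.mem_natSpan_univ hy) (by simpa [h]))

variable [P.IsCrystallographic]

/-- A sum of non-negative integers vanishes only if every term does: an element of `ℕS` orthogonal
to `e` therefore involves only simple roots orthogonal to `e`. This drives the descent in the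
cascade. -/
lemma exists_nat_eq_apply_coroot {S : Set b.support} (e : ι)
    (hS : ∀ a ∈ S, 0 ≤ P.pairingIn ℤ a e) {x : M} (hx : x ∈ b.natSpan S) :
    ∃ n : ℕ, P.toLinearMap x (P.coroot e) = n ∧
      (n = 0 → x ∈ b.natSpan {a ∈ S | P.pairing a e = 0}) := by
  induction hx using AddSubmonoid.closure_induction with
  | mem x hx =>
    obtain ⟨a, ha, rfl⟩ := hx
    obtain ⟨n, hn⟩ := Int.eq_ofNat_of_zero_le (hS a ha)
    have hn' : P.pairing a e = n := by rw [← P.algebraMap_pairingIn ℤ, hn]; simp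
    refine ⟨n, by simpa using hn', fun h ↦ b.root_mem_natSpan ⟨ha, by simp [hn', h]⟩⟩
  | zero => exact ⟨0, by simp, fun _ ↦ zero_mem _⟩
  | add x y _ _ hx hy =>
    obtain ⟨m, hm, hm'⟩ := hx
    obtain ⟨n, hn, hn'⟩ := hy
    refine ⟨m + n, by simp [hm, hn], fun h ↦ add_mem (hm' (by omega)) (hn' (by omega))⟩

lemma pairingIn_nonneg_of_forall {S : Set b.support} {e i : ι}
    (hS : ∀ a ∈ S, 0 ≤ P.pairingIn ℤ a e) (hi : i ∈ b.posRoots S) : 0 ≤ P.pairingIn ℤ i e := by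
  obtain ⟨n, hn, -⟩ := b.exists_nat_eq_apply_coroot e hS hi
  rw [P.root_coroot_eq_pairing, ← P.algebraMap_pairingIn ℤ, eq_intCast] at hn
  have : P.pairingIn ℤ i e = n := by exact_mod_cast hn
  omega

lemma mem_posRoots_of_pairing_eq_zero {S : Set b.support} {e i : ι}
    (hS : ∀ a ∈ S, 0 ≤ P.pairingIn ℤ a e) (hi : i ∈ b.posRoots S) (h : P.pairing i e = 0) :
    i ∈ b.posRoots {a ∈ S | P.pairing a e = 0} := by
  obtain ⟨n, hn, hn'⟩ := b.exists_nat_eq_apply_coroot e hS hi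
  rw [P.root_coroot_eq_pairing, h] at hn
  exact hn' (by exact_mod_cast hn.symm)

lemma apply_coroot_eq_zero_of_forall {S : Set b.support} {e : ι}
    (hS : ∀ a ∈ S, P.pairing a e = 0) {x : M} (hx : x ∈ b.natSpan S) :
    P.toLinearMap x (P.coroot e) = 0 := by
  induction hx using AddSubmonoid.closure_induction with
  | mem x hx =>
    obtain ⟨a, ha, rfl⟩ := hx
    simpa using hS a ha
  | zero => simp
  | add x y _ _ hx hy => simp [hx, hy]

end Cone

end RootPairing.Base

namespace RootPairing.Base

/-! ### Existence, uniqueness and pairings of the highest root. -/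

section HighestRoot

variable {ι K M N : Type*} [Field K] [CharZero K] [AddCommGroup M] [Module K M]
  [AddCommGroup N] [Module K N] {P : RootPairing ι K M N} (b : P.Base)
  [Finite ι] [P.IsCrystallographic]

lemma pairing_eq_zero_iff_pairingIn {i j : ι} : P.pairing i j = 0 ↔ P.pairingIn ℤ i j = 0 := by
  rw [← P.algebraMap_pairingIn ℤ, eq_intCast, Int.cast_eq_zero]

lemma dynkinGraph_adj {a c : b.support} :
    b.dynkinGraph.Adj a c ↔ a ≠ c ∧ P.pairing a c ≠ 0 := by
  have := P.pairing_eq_zero_iff (i := a) (j := c)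
  rw [dynkinGraph, SimpleGraph.fromRel_adj]
  tauto

lemma IsConn.nonempty {S : Set b.support} (hS : b.IsConn S) : S.Nonempty := by
  obtain ⟨a⟩ := SimpleGraph.Connected.nonempty hS
  exact ⟨a, a.2⟩

lemma isConn_singleton (a : b.support) : b.IsConn {a} := by
  rw [IsConn, SimpleGraph.connected_iff_exists_forall_reachable]
  refine ⟨⟨a, rfl⟩, fun ⟨c, hc⟩ ↦ ?_⟩
  obtain rfl : c = a := hc
  exact SimpleGraph.Reachable.refl _

variable {b}

lemma IsConn.exists_pairing_ne_zero {S A : Set b.support} (hS : b.IsConn S) (hA : A ⊆ S)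
    (hne : A.Nonempty) (hAS : A ≠ S) : ∃ a ∈ A, ∃ c ∈ S, c ∉ A ∧ P.pairing a c ≠ 0 := by
  obtain ⟨a, ha⟩ := hne
  obtain ⟨c, hc, hcA⟩ : ∃ c ∈ S, c ∉ A := by
    by_contra! h
    exact hAS (hA.antisymm h)
  obtain ⟨p⟩ := hS.preconnected ⟨a, hA ha⟩ ⟨c, hc⟩
  obtain ⟨d, -, h₁, h₂⟩ := p.exists_boundary_dart {x : S | x.1 ∈ A} ha hcA
  exact ⟨d.fst, h₁, d.snd, d.snd.2, h₂, (b.dynkinGraph_adj.mp d.adj).2⟩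

variable (b)

/-- The index `i` is a maximal element of `R^S_+`. -/
def IsMaxRoot (S : Set b.support) (i : ι) : Prop :=
  i ∈ b.posRoots S ∧ ∀ j ∈ b.posRoots S, P.root j - P.root i ∈ b.natSpan Set.univ → j = i

lemma exists_isMaxRoot_ge {S : Set b.support} {i : ι} (hi : i ∈ b.posRoots S) :
    ∃ j, b.IsMaxRoot S j ∧ P.root j - P.root i ∈ b.natSpan Set.univ := by
  let r : ι → ι → Prop := fun j k ↦ j ≠ k ∧ P.root j - P.root k ∈ b.natSpan Set.univ
  have : IsTrans ι r := ⟨by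
    rintro j k l ⟨h₁, h₂⟩ ⟨h₃, h₄⟩
    refine ⟨?_, by simpa using add_mem h₂ h₄⟩
    rintro rfl
    exact h₁ (P.root.injective (sub_eq_zero.mp
      (b.eq_zero_of_mem_natSpan_of_neg_mem h₂ (by simpa using h₄))))⟩
  have : Std.Irrefl r := ⟨fun j h ↦ h.1 rfl⟩
  have hwf : WellFounded r := Finite.wellFounded_of_trans_of_irrefl r
  obtain ⟨j, ⟨hj, hji⟩, hmin⟩ := hwf.has_min
    {j | j ∈ b.posRoots S ∧ P.root j - P.root i ∈ b.natSpan Set.univ} ⟨i, hi, by simp⟩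
  refine ⟨j, ⟨hj, fun k hk hkj ↦ ?_⟩, hji⟩
  by_contra hne
  exact hmin k ⟨hk, by simpa using add_mem hkj hji⟩ ⟨hne, hkj⟩

variable {b}

lemma IsMaxRoot.add_notMem {S : Set b.support} {i j : ι} (hi : b.IsMaxRoot S i)
    (hj : j ∈ b.posRoots S) : P.root i + P.root j ∉ Set.range P.root := by
  rintro ⟨k, hk⟩
  have hkS : k ∈ b.posRoots S := by
    change P.root k ∈ b.natSpan S
    rw [hk]
    exact add_mem hi.1 hj
  obtain rfl := hi.2 k hkS (by simpa [hk] using b.mem_natSpan_univ hj)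
  exact P.ne_zero j (by simpa using hk)

lemma IsMaxRoot.pairingIn_nonneg {S : Set b.support} {i j : ι} (hi : b.IsMaxRoot S i)
    (hj : j ∈ b.posRoots S) : 0 ≤ P.pairingIn ℤ i j := by
  by_contra! h
  refine hi.add_notMem hj (P.root_add_root_mem_of_pairingIn_neg h fun h' ↦ ?_)
  exact P.ne_zero j (b.eq_zero_of_mem_natSpan_of_neg_mem (b.mem_natSpan_univ hj)
    (h' ▸ b.mem_natSpan_univ hi.1))

lemma IsMaxRoot.pairingIn_nonneg' {S : Set b.support} {i j : ι} (hi : b.IsMaxRoot S i)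
    (hj : j ∈ b.posRoots S) : 0 ≤ P.pairingIn ℤ j i := by
  rcases (hi.pairingIn_nonneg hj).eq_or_lt with h | h
  · rw [P.pairingIn_eq_zero_iff.mp h.symm]
  · exact ((P.zero_lt_pairingIn_iff' ℤ).mp h).le

/-- A maximal root has full support. Otherwise some `c ∈ S` outside the support `A` is joined to an
element of `A`. The pairing of `i` with `c` is non-positive since `c ∉ A`, and non-negative by
maximality, so it is zero and all of `A` is orthogonal to `c`. -/
lemma IsMaxRoot.sub_mem {S : Set b.support} (hS : b.IsConn S) {i : ι} (hi : b.IsMaxRoot S i)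
    {a : b.support} (ha : a ∈ S) : P.root i - P.root a ∈ b.natSpan S := by
  set A : Set b.support := {a ∈ S | P.root i - P.root a ∈ b.natSpan S} with hA
  have hiA : P.root i ∈ b.natSpan A := b.mem_natSpan_support hi.1
  suffices A = S by
    rw [← this] at ha
    exact ha.2
  by_contra hne
  have hAne : A.Nonempty := by
    rw [Set.nonempty_iff_ne_empty]
    intro h
    rw [h] at hiA
    exact P.ne_zero i (b.eq_zero_of_mem_natSpan_empty hiA)
  obtain ⟨a, ha, c, hc, hcA, hac⟩ := hS.exists_pairing_ne_zero (Set.sep_subset _ _) hAne hne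
  -- Replacing `c` by `-c` turns the non-positive pairings into non-negative ones, as the cone
  -- lemmas require.
  let _i := P.indexNeg
  have hneg : ∀ x ∈ A, 0 ≤ P.pairingIn ℤ x (-(c : ι)) := by
    intro x hx
    have hxc : (x : ι) ≠ c := fun h ↦ hcA (by rwa [← Subtype.ext h])
    have := b.pairingIn_le_zero_of_ne hxc x.2 c.2
    simpa using this
  have h1 : P.pairingIn ℤ i c = 0 := by
    refine le_antisymm ?_ (hi.pairingIn_nonneg (b.root_mem_natSpan hc))
    have := b.pairingIn_nonneg_of_forall hneg (i := i) hiA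
    simpa using this
  have h2 := b.mem_posRoots_of_pairing_eq_zero hneg (i := i) hiA
    (by rw [pairing_eq_zero_iff_pairingIn]; simpa using h1)
  have h3 := b.mem_of_sub_mem_natSpan h2 (b.mem_natSpan_univ ha.2)
  exact hac (by simpa using h3.2)

/-- As `i` has full support and `j` is not orthogonal to all of `S`, the two pair positively. If
distinct, their difference is a root, positive or negative, which contradicts one of the two
maximalities. -/
lemma IsMaxRoot.unique {S : Set b.support} (hS : b.IsConn S) {i j : ι} (hi : b.IsMaxRoot S i)
    (hj : b.IsMaxRoot S j) : i = j := by
  have hnn : ∀ a ∈ S, 0 ≤ P.pairingIn ℤ a j := fun a ha ↦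
    hj.pairingIn_nonneg' (b.root_mem_natSpan ha)
  have hpos : 0 < P.pairingIn ℤ i j := by
    refine (b.pairingIn_nonneg_of_forall hnn hi.1).lt_of_ne fun h ↦ ?_
    have h2 := b.mem_posRoots_of_pairing_eq_zero hnn hi.1 (pairing_eq_zero_iff_pairingIn.mpr h.symm)
    have h3 : ∀ a ∈ S, P.pairing a j = 0 := fun a ha ↦
      (b.mem_of_sub_mem_natSpan h2 (b.mem_natSpan_univ (hi.sub_mem hS ha))).2
    have := b.apply_coroot_eq_zero_of_forall h3 hj.1
    simp at this
  by_contra hij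
  obtain ⟨k, hk⟩ := P.root_sub_root_mem_of_pairingIn_pos hpos hij
  rcases b.root_mem_natSpan_univ_or_neg k with h | h
  · exact hij (hj.2 i hi.1 (hk ▸ h))
  · exact hij (hi.2 j hj.1 (by simpa [hk] using h)).symm

lemma IsMaxRoot.isHighestRoot {S : Set b.support} (hS : b.IsConn S) {i : ι}
    (hi : b.IsMaxRoot S i) : b.IsHighestRoot S i := by
  refine ⟨b.posRoots_subset_rootsOf S hi.1, fun j hj ↦ ?_⟩
  rcases b.mem_posRoots_or_neg_of_mem_rootsOf hj with h | h
  · obtain ⟨k, hk, hkj⟩ := b.exists_isMaxRoot_ge h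
    obtain rfl := hi.unique hS hk
    exact b.sub_mem_natSpan_of_mem hi.1 (b.mem_natSpan_univ h) hkj
  · simpa [sub_eq_add_neg] using add_mem hi.1 h

lemma IsConn.exists_isHighestRoot {S : Set b.support} (hS : b.IsConn S) :
    ∃ e, b.IsHighestRoot S e := by
  obtain ⟨a, ha⟩ := hS.nonempty
  obtain ⟨j, hj, -⟩ := b.exists_isMaxRoot_ge (i := a) (b.root_mem_natSpan ha)
  exact ⟨j, hj.isHighestRoot hS⟩

lemma IsHighestRoot.unique {S : Set b.support} {e e' : ι} (he : b.IsHighestRoot S e)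
    (he' : b.IsHighestRoot S e') : e = e' :=
  P.root.injective (sub_eq_zero.mp (b.eq_zero_of_mem_natSpan_of_neg_mem
    (b.mem_natSpan_univ (he.2 e' he'.1))
    (by simpa using b.mem_natSpan_univ (he'.2 e he.1))))

lemma IsHighestRoot.mem_posRoots {S : Set b.support} {e : ι} (he : b.IsHighestRoot S e) :
    e ∈ b.posRoots S := by
  rcases b.mem_posRoots_or_neg_of_mem_rootsOf he.1 with h | h
  · exact h
  let _i := P.indexNeg
  have h1 : -e ∈ b.rootsOf S := b.posRoots_subset_rootsOf S (by simpa [posRoots] using h)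
  have h2 := he.2 _ h1
  have h3 : P.root e = 0 := b.eq_zero_of_mem_natSpan_of_neg_mem (b.mem_natSpan_univ
    (by simpa using add_mem (add_mem h2 h) (show (0 : M) ∈ b.natSpan S from zero_mem _)))
    (b.mem_natSpan_univ h)
  exact (P.ne_zero e h3).elim

lemma IsHighestRoot.sub_mem {S : Set b.support} {e i : ι} (he : b.IsHighestRoot S e)
    (hi : i ∈ b.posRoots S) : P.root e - P.root i ∈ b.natSpan S :=
  he.2 i (b.posRoots_subset_rootsOf S hi)

lemma IsHighestRoot.isMaxRoot {S : Set b.support} {e : ι} (he : b.IsHighestRoot S e) :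
    b.IsMaxRoot S e := by
  refine ⟨he.mem_posRoots, fun j hj h ↦ P.root.injective (sub_eq_zero.mp
    (b.eq_zero_of_mem_natSpan_of_neg_mem h ?_))⟩
  simpa using b.mem_natSpan_univ (he.sub_mem hj)

/-- If `ε_S ∈ ℕT` then `S ⊆ T`. -/
lemma IsHighestRoot.subset {S T : Set b.support} {e : ι} (he : b.IsHighestRoot S e)
    (h : e ∈ b.posRoots T) : S ⊆ T := fun a ha ↦ by
  have ha' : (a : ι) ∈ b.posRoots S := b.root_mem_natSpan ha
  exact b.mem_of_sub_mem_natSpan h (b.mem_natSpan_univ (he.sub_mem ha'))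

lemma IsHighestRoot.set_eq {S T : Set b.support} {e : ι} (hS : b.IsHighestRoot S e)
    (hT : b.IsHighestRoot T e) : S = T :=
  (hS.subset hT.mem_posRoots).antisymm (hT.subset hS.mem_posRoots)

lemma IsHighestRoot.forall_nonneg {S : Set b.support} {e : ι} (he : b.IsHighestRoot S e) :
    ∀ a ∈ S, 0 ≤ P.pairingIn ℤ a e := fun _ ha ↦
  he.isMaxRoot.pairingIn_nonneg' (b.root_mem_natSpan ha)

variable [P.IsReduced]

/-- If the pairing is `n ≥ 2`, the root `n e - i` of `R^S` is below `e`, so `i - (n - 1) e` is in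
the cone; adding `(n - 2) e` puts `i - e` there, while `e - i` is there already. -/
lemma IsHighestRoot.pairingIn_le_one {S : Set b.support} {e i : ι} (he : b.IsHighestRoot S e)
    (hi : i ∈ b.posRoots S) (hie : i ≠ e) : P.pairingIn ℤ i e ≤ 1 := by
  by_contra! h
  have hr : P.root (P.reflectionPerm e i) = P.root i - P.pairingIn ℤ i e • P.root e := by
    rw [root_reflectionPerm, reflection_apply_root' ℤ]
  set k := P.reflectionPerm e i
  have hk : P.root (P.reflectionPerm k k) = -P.root k := by simp
  have hmem : P.reflectionPerm k k ∈ b.rootsOf S := by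
    have h1 : P.root i ∈ b.intSpan S := b.natSpan_le_intSpan S hi
    have h2 : P.root e ∈ b.intSpan S := b.natSpan_le_intSpan S he.mem_posRoots
    change P.root (P.reflectionPerm k k) ∈ b.intSpan S
    rw [hk, hr]
    exact neg_mem (_root_.sub_mem h1 (zsmul_mem h2 _))
  have h1 := b.mem_natSpan_univ (he.2 _ hmem)
  rw [hk, hr] at h1
  have h2 := b.mem_natSpan_univ (he.sub_mem hi)
  obtain ⟨n, hn⟩ := Int.eq_ofNat_of_zero_le (a := P.pairingIn ℤ i e - 2) (by omega)
  have hn' : P.pairingIn ℤ i e = n + 2 := by omega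
  have h3 : n • P.root e ∈ b.natSpan Set.univ := nsmul_mem (b.mem_natSpan_univ he.mem_posRoots) n
  refine hie (P.root.injective (sub_eq_zero.mp (b.eq_zero_of_mem_natSpan_of_neg_mem ?_ ?_)))
  · convert add_mem h1 h3 using 1
    rw [hn', add_smul, natCast_zsmul, two_zsmul]
    abel
  · simpa using h2

/-- The roots of `R^S_+` not orthogonal to `ε_S`, other than `ε_S`, come in pairs of sum `ε_S`. -/
lemma IsHighestRoot.exists_add_eq {S : Set b.support} {e i : ι} (he : b.IsHighestRoot S e)
    (hi : i ∈ b.posRoots S) (hie : i ≠ e) (hpos : 0 < P.pairingIn ℤ i e) :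
    P.pairingIn ℤ i e = 1 ∧ ∃ j ∈ b.posRoots S, P.root i + P.root j = P.root e ∧
      P.pairingIn ℤ j e = 1 ∧ j ≠ e ∧ j ≠ i := by
  have h1 : P.pairingIn ℤ i e = 1 := le_antisymm (he.pairingIn_le_one hi hie) hpos
  refine ⟨h1, ?_⟩
  obtain ⟨j, hj⟩ := P.root_sub_root_mem_of_pairingIn_pos ((P.zero_lt_pairingIn_iff' ℤ).mp hpos) hie.symm
  have hij : P.root e = P.root i + P.root j := by rw [hj]; abel
  have hje : P.pairingIn ℤ j e = 1 := by
    have := P.pairingIn_eq_add_of_root_eq_add (S := ℤ) (j := e) hij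
    rw [pairingIn_same, h1] at this
    omega
  refine ⟨j, ?_, hij.symm, hje, ?_, ?_⟩
  · change P.root j ∈ b.natSpan S
    rw [hj]
    exact he.sub_mem hi
  · rintro rfl
    simp at hje
  -- Here `e` would be twice a root, which a reduced system forbids.
  · rintro rfl
    have : IsAddTorsionFree M := .of_isTorsionFree K M
    exact P.nsmul_notMem_range_root (n := 2) (i := j) ⟨e, by rw [hij, two_nsmul]⟩

end HighestRoot

end RootPairing.Base

namespace RootPairing.Base

/-! ### The cascade: each positive root belongs to exactly one member. -/

section Cascade

variable {ι K M N : Type*} [Field K] [CharZero K] [AddCommGroup M] [Module K M]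
  [AddCommGroup N] [Module K N] {P : RootPairing ι K M N} {b : P.Base}
  [Finite ι] [P.IsCrystallographic]

lemma IsConn.isComponent_self {S : Set b.support} (hS : b.IsConn S) : b.IsComponent S S :=
  ⟨⟨subset_rfl, hS⟩, fun _ h _ ↦ h.1⟩

lemma IsComponent.eq_of_isConn {S C : Set b.support} (hC : b.IsComponent S C) (hS : b.IsConn S) :
    C = S :=
  hC.eq_of_subset ⟨subset_rfl, hS⟩ hC.prop.1

lemma IsComponent.pairing_eq_zero {S C : Set b.support} (hC : b.IsComponent S C) {a c : b.support}
    (ha : a ∈ C) (hc : c ∈ S) (hcC : c ∉ C) : P.pairing a c = 0 := by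
  by_contra h
  have hadj : b.dynkinGraph.Adj a c :=
    b.dynkinGraph_adj.mpr ⟨fun h ↦ hcC (h ▸ ha), h⟩
  have hconn : b.IsConn (C ∪ {c}) := SimpleGraph.connected_induce_union hC.prop.2.preconnected
    (b.isConn_singleton c).preconnected ha rfl hadj
  exact hcC (hC.2 ⟨Set.union_subset hC.prop.1 (by simpa), hconn⟩ Set.subset_union_left
    (Set.mem_union_right _ rfl))

lemma IsComponent.disjoint {S C C' : Set b.support} (hC : b.IsComponent S C)
    (hC' : b.IsComponent S C') (hne : C ≠ C') : Disjoint C C' := by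
  rw [Set.disjoint_iff_inter_eq_empty]
  by_contra h
  have hconn : b.IsConn (C ∪ C') := SimpleGraph.induce_union_connected hC.prop.2.preconnected
    hC'.prop.2.preconnected (Set.nonempty_iff_ne_empty.mpr h)
  have hu : C ∪ C' ⊆ S := Set.union_subset hC.prop.1 hC'.prop.1
  exact hne ((hC.eq_of_subset ⟨hu, hconn⟩ Set.subset_union_left).trans
    (hC'.eq_of_subset ⟨hu, hconn⟩ Set.subset_union_right).symm)

lemma exists_isComponent_mem {S : Set b.support} {a : b.support} (ha : a ∈ S) :
    ∃ C, b.IsComponent S C ∧ a ∈ C := by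
  obtain ⟨C, hC, hmax⟩ := (Set.toFinite {C' : Set b.support | C' ⊆ S ∧ b.IsConn C'}).exists_le_maximal
    (a := {a}) ⟨by simpa, b.isConn_singleton a⟩
  exact ⟨C, hmax, hC rfl⟩

/-- The support of a positive root is connected. -/
lemma exists_isComponent_mem_posRoots {S : Set b.support} {i : ι} (hi : i ∈ b.posRoots S) :
    ∃ C, b.IsComponent S C ∧ i ∈ b.posRoots C := by
  have hpos : b.IsPos i := by
    by_contra h
    have h' := (IsPos.neg_iff_not b i).mpr h
    have hp : ∀ j, b.IsPos j → P.root j ∈ b.natSpan Set.univ := fun j hj ↦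
      hj.induction_on_add (p := fun j ↦ P.root j ∈ b.natSpan Set.univ)
        (fun a ha ↦ b.root_mem_natSpan (a := ⟨a, ha⟩) trivial)
        (fun i a k h₁ h₂ ha ↦ h₁ ▸ add_mem h₂ (b.root_mem_natSpan (a := ⟨a, ha⟩) trivial))
    have h2 := hp _ h'
    rw [show P.root _ = -P.root i by simp] at h2
    exact P.ne_zero i (b.eq_zero_of_mem_natSpan_of_neg_mem (b.mem_natSpan_univ hi) h2)
  suffices P.root i ∈ b.natSpan Set.univ ∧ (i ∈ b.posRoots S →
      ∃ C, b.IsComponent S C ∧ i ∈ b.posRoots C) from this.2 hi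
  refine hpos.induction_on_add (p := fun i ↦ P.root i ∈ b.natSpan Set.univ ∧ (i ∈ b.posRoots S →
      ∃ C, b.IsComponent S C ∧ i ∈ b.posRoots C)) ?_ ?_
  · intro a ha
    refine ⟨b.root_mem_natSpan (a := ⟨a, ha⟩) trivial, fun hi ↦ ?_⟩
    have haS : ⟨a, ha⟩ ∈ S := b.root_mem_natSpan_iff.mp hi
    obtain ⟨C, hC, haC⟩ := exists_isComponent_mem haS
    exact ⟨C, hC, b.root_mem_natSpan haC⟩
  · rintro i a k hk ⟨hi, ih⟩ ha
    lift a to b.support using ha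
    have haU : P.root a ∈ b.natSpan Set.univ := b.root_mem_natSpan trivial
    refine ⟨hk ▸ add_mem hi haU, fun hkS ↦ ?_⟩
    change P.root k ∈ b.natSpan S at hkS
    rw [hk] at hkS
    have hiS : i ∈ b.posRoots S := b.mem_natSpan_of_add_mem hi haU hkS
    have haS : a ∈ S := b.root_mem_natSpan_iff.mp
      (b.mem_natSpan_of_add_mem haU hi (by rwa [add_comm]))
    obtain ⟨C, hC, hiC⟩ := ih hiS
    by_cases haC : a ∈ C
    · exact ⟨C, hC, by
        change P.root k ∈ b.natSpan C
        rw [hk]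
        exact add_mem hiC (b.root_mem_natSpan haC)⟩
    -- A simple root `a` outside `C` is orthogonal to `i`, so reflection in `a` sends `i + a` to `i
    -- - a`, whose coefficients have both signs.
    exfalso
    have hia : P.pairing i a = 0 := by
      simpa using b.apply_coroot_eq_zero_of_forall (e := a)
        (fun c hc ↦ hC.pairing_eq_zero hc haS haC) hiC
    have hka : P.pairing k a = 2 := by
      rw [P.pairing_eq_add_of_root_eq_add hk, hia]
      simp
    have hr : P.root (P.reflectionPerm a k) = P.root i - P.root a := by
      rw [root_reflectionPerm, reflection_apply_root, hka, hk, two_smul]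
      abel
    rcases b.root_mem_natSpan_univ_or_neg (P.reflectionPerm a k) with h | h
    · rw [hr] at h
      exact haC (b.mem_of_sub_mem_natSpan hiC h)
    · rw [hr, neg_sub] at h
      have ha' : P.root a ∈ b.natSpan {a} := b.root_mem_natSpan (Set.mem_singleton a)
      have h1 : P.root i ∈ b.natSpan {a} := b.mem_natSpan_of_add_mem hi h (by simpa)
      have h2 := b.mem_natSpan_inter hiC h1
      rw [Set.inter_singleton_eq_empty.mpr haC] at h2
      exact P.ne_zero i (b.eq_zero_of_mem_natSpan_empty h2)

/-- The `component` rule gives nothing new here, a connected set being its own only component. -/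
lemma InCascade.eq_or_orthogonal {S K : Set b.support} (h : b.InCascade S K) (hS : b.IsConn S) :
    K = S ∨ ∃ e, b.IsHighestRoot S e ∧ b.InCascade {a ∈ S | P.pairing a e = 0} K := by
  induction h with
  | component hC hK ih =>
    obtain rfl := hC.eq_of_isConn hS
    exact ih hS
  | self => exact Or.inl rfl
  | orthogonal _ he hK => exact Or.inr ⟨_, he, hK⟩

lemma InCascade.exists_isComponent {S K : Set b.support} (h : b.InCascade S K) :
    ∃ C, b.IsComponent S C ∧ b.InCascade C K := by
  cases h with
  | component hC hK => exact ⟨_, hC, hK⟩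
  | self hS => exact ⟨_, hS.isComponent_self, .self hS⟩
  | orthogonal hS he hK => exact ⟨_, hS.isComponent_self, .orthogonal hS he hK⟩

lemma InCascade.subset {S K : Set b.support} (h : b.InCascade S K) : K ⊆ S := by
  induction h with
  | component hC _ ih => exact ih.trans hC.prop.1
  | self => exact subset_rfl
  | orthogonal _ _ _ ih => exact ih.trans (Set.sep_subset _ _)

lemma InCascade.isConn {S K : Set b.support} (h : b.InCascade S K) : b.IsConn K := by
  induction h with
  | component _ _ ih => exact ih
  | self hS => exact hS
  | orthogonal _ _ _ ih => exact ih

/-- Otherwise `e` would be orthogonal to itself. The strict decrease justifies induction along the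
recursion. -/
lemma IsHighestRoot.sep_ssubset {S : Set b.support} {e : ι} (he : b.IsHighestRoot S e) :
    {a ∈ S | P.pairing a e = 0} ⊂ S := by
  refine (Set.sep_subset _ _).ssubset_of_ne fun h ↦ ?_
  have := b.apply_coroot_eq_zero_of_forall (fun a ha ↦ (h.symm ▸ ha : a ∈ {a ∈ S | _}).2)
    he.mem_posRoots
  simp at this

/-- Two elements of `𝒦(S)` are equal, disjoint, or one is orthogonal to the highest root of the
other. -/
lemma InCascade.trichotomy {S K L : Set b.support} (hK : b.InCascade S K) (hL : b.InCascade S L) :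
    K = L ∨ Disjoint K L ∨ (∃ e, b.IsHighestRoot L e ∧ ∀ a ∈ K, P.pairing a e = 0) ∨
      ∃ e, b.IsHighestRoot K e ∧ ∀ a ∈ L, P.pairing a e = 0 := by
  induction S using WellFoundedLT.induction with
  | ind S ih =>
  by_cases hS : b.IsConn S
  · rcases hK.eq_or_orthogonal hS with rfl | ⟨e, he, hK⟩ <;>
      rcases hL.eq_or_orthogonal hS with rfl | ⟨e', he', hL⟩
    · exact Or.inl rfl
    · exact Or.inr (Or.inr (Or.inr ⟨e', he', fun a ha ↦ (hL.subset ha).2⟩))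
    · exact Or.inr (Or.inr (Or.inl ⟨e, he, fun a ha ↦ (hK.subset ha).2⟩))
    · obtain rfl := he.unique he'
      exact ih _ he.sep_ssubset hK hL
  · obtain ⟨C, hC, hK⟩ := hK.exists_isComponent
    obtain ⟨C', hC', hL⟩ := hL.exists_isComponent
    by_cases h : C = C'
    · subst h
      exact ih C (hC.prop.1.ssubset_of_ne fun h ↦ hS (h ▸ hC.prop.2)) hK hL
    · exact Or.inr (Or.inl ((hC.disjoint hC' h).mono hK.subset hL.subset))

/-- Descend the recursion: a positive root lives on one component, and there it either pairs
positively with the highest root or is supported on the simple roots orthogonal to it. -/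
lemma exists_inCascade_pairingIn_pos {S : Set b.support} {i : ι} (hi : i ∈ b.posRoots S) :
    ∃ K e, b.InCascade S K ∧ b.IsHighestRoot K e ∧ i ∈ b.posRoots K ∧ 0 < P.pairingIn ℤ i e := by
  induction S using WellFoundedLT.induction with
  | ind S ih =>
  by_cases hS : b.IsConn S
  · obtain ⟨e, he⟩ := hS.exists_isHighestRoot
    rcases (b.pairingIn_nonneg_of_forall he.forall_nonneg hi).eq_or_lt with h | h
    · obtain ⟨K, e', hK, h'⟩ := ih _ he.sep_ssubset (b.mem_posRoots_of_pairing_eq_zero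
        he.forall_nonneg hi (pairing_eq_zero_iff_pairingIn.mpr h.symm))
      exact ⟨K, e', .orthogonal hS he hK, h'⟩
    · exact ⟨S, e, .self hS, he, hi, h⟩
  · obtain ⟨C, hC, hiC⟩ := exists_isComponent_mem_posRoots hi
    obtain ⟨K, e, hK, h'⟩ := ih C (hC.prop.1.ssubset_of_ne fun h ↦ hS (h ▸ hC.prop.2)) hiC
    exact ⟨K, e, .component hC hK, h'⟩

lemma InCascade.eq_of_pairingIn_pos {S K L : Set b.support} {e f i : ι} (hK : b.InCascade S K)
    (hL : b.InCascade S L) (he : b.IsHighestRoot K e) (hf : b.IsHighestRoot L f)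
    (hiK : i ∈ b.posRoots K) (hiL : i ∈ b.posRoots L) (hie : 0 < P.pairingIn ℤ i e)
    (hif : 0 < P.pairingIn ℤ i f) : K = L := by
  have key : ∀ {K : Set b.support} {e e' : ι}, b.IsHighestRoot K e → i ∈ b.posRoots K →
      0 < P.pairingIn ℤ i e' → ¬ ∀ a ∈ K, P.pairing a e' = 0 := by
    intro K e e' he hi hpos h
    have := b.apply_coroot_eq_zero_of_forall h hi
    rw [P.root_coroot_eq_pairing, pairing_eq_zero_iff_pairingIn] at this
    omega
  rcases hK.trichotomy hL with h | h | ⟨e', he', h⟩ | ⟨e', he', h⟩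
  · exact h
  · have := b.mem_natSpan_inter hiK hiL
    rw [Set.disjoint_iff_inter_eq_empty.mp h] at this
    exact (P.ne_zero i (b.eq_zero_of_mem_natSpan_empty this)).elim
  · obtain rfl := he'.unique hf
    exact (key he hiK hif h).elim
  · obtain rfl := he'.unique he
    exact (key hf hiL hie h).elim

end Cascade

end RootPairing.Base

namespace RootPairing.Base

/-! ### The classes of positive roots, their partners and parity. -/

section CascadeRoots

variable {ι K M N : Type*} [Field K] [CharZero K] [AddCommGroup M] [Module K M]
  [AddCommGroup N] [Module K N] {P : RootPairing ι K M N} (b : P.Base)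
  [Finite ι] [P.IsCrystallographic]

/-- The highest roots `ε_K` for `K ∈ 𝒦(S)`. -/
def cascadeRoots (S : Set b.support) : Set ι :=
  {e | ∃ K, b.InCascade S K ∧ b.IsHighestRoot K e}

/-- The root `e` is the highest root of the member of `𝒦(S)` to which `i ∈ R^S_+` belongs. -/
def IsCascadeTop (S : Set b.support) (i e : ι) : Prop :=
  ∃ K, b.InCascade S K ∧ b.IsHighestRoot K e ∧ i ∈ b.posRoots K ∧ 0 < P.pairingIn ℤ i e

open Classical in
/-- The highest root of the member of `𝒦(S)` to which `i ∈ R^S_+` belongs. -/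
def cascadeTop (S : Set b.support) (i : ι) : ι :=
  if h : ∃ e, b.IsCascadeTop S i e then h.choose else i

/-- A rapidly growing function of the size of the support of a positive root. -/
def supportWeight (i : ι) : ℕ :=
  3 ^ {a : b.support | P.root i - P.root a ∈ b.natSpan Set.univ}.ncard

variable {b}

lemma isCascadeTop_cascadeTop {S : Set b.support} {i : ι} (hi : i ∈ b.posRoots S) :
    b.IsCascadeTop S i (b.cascadeTop S i) := by
  obtain ⟨K, e, h⟩ := exists_inCascade_pairingIn_pos hi
  have h' : ∃ e, b.IsCascadeTop S i e := ⟨e, K, h⟩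
  rw [cascadeTop, dif_pos h']
  exact h'.choose_spec

lemma IsCascadeTop.cascadeTop_eq {S : Set b.support} {i e : ι} (h : b.IsCascadeTop S i e) :
    b.cascadeTop S i = e := by
  have h' : ∃ e, b.IsCascadeTop S i e := ⟨e, h⟩
  rw [cascadeTop, dif_pos h']
  obtain ⟨L, hL, hf, hiL, hif⟩ := h'.choose_spec
  obtain ⟨K, hK, he, hiK, hie⟩ := h
  obtain rfl := hK.eq_of_pairingIn_pos hL he hf hiK hiL hie hif
  exact hf.unique he

lemma cascadeTop_mem {S : Set b.support} {i : ι} (hi : i ∈ b.posRoots S) :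
    b.cascadeTop S i ∈ b.cascadeRoots S := by
  obtain ⟨K, hK, he, -⟩ := isCascadeTop_cascadeTop hi
  exact ⟨K, hK, he⟩

lemma cascadeRoots_subset (S : Set b.support) : b.cascadeRoots S ⊆ b.posRoots S := by
  rintro e ⟨K, hK, he⟩
  exact b.natSpan_mono hK.subset he.mem_posRoots

lemma cascadeTop_eq_self {S : Set b.support} {e : ι} (he : e ∈ b.cascadeRoots S) :
    b.cascadeTop S e = e := by
  obtain ⟨K, hK, he⟩ := he
  exact IsCascadeTop.cascadeTop_eq ⟨K, hK, he, he.mem_posRoots, by simp⟩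

lemma root_add_cascadeTop_notMem {S : Set b.support} {i : ι} (hi : i ∈ b.posRoots S) :
    P.root i + P.root (b.cascadeTop S i) ∉ Set.range P.root := by
  obtain ⟨K, -, he, hiK, -⟩ := isCascadeTop_cascadeTop hi
  rw [add_comm]
  exact he.isMaxRoot.add_notMem hiK

lemma supportWeight_of_isHighestRoot {K : Set b.support} {e : ι} (he : b.IsHighestRoot K e) :
    b.supportWeight e = 3 ^ K.ncard := by
  rw [supportWeight]
  congr 2
  ext a
  refine ⟨fun h ↦ b.mem_of_sub_mem_natSpan he.mem_posRoots h, fun h ↦ ?_⟩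
  have ha : (a : ι) ∈ b.posRoots K := b.root_mem_natSpan h
  exact b.mem_natSpan_univ (he.sub_mem ha)

/-- If `ε_K` lies strictly below a root of the class of `L`, then `K ⊂ L` strictly, since `K = L`
would put that root below `ε_K`. Base 3 then absorbs the factor 2: `2 * 3^|K| < 3^(|K| + 1) ≤
3^|L|`. -/
lemma two_mul_supportWeight_lt {S : Set b.support} {i e : ι} (hi : i ∈ b.posRoots S)
    (he : e ∈ b.cascadeRoots S) (h : P.root i - P.root e ∈ b.natSpan Set.univ) (hne : i ≠ e) :
    2 * b.supportWeight e < b.supportWeight (b.cascadeTop S i) := by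
  obtain ⟨L, hL, hf, hiL, -⟩ := isCascadeTop_cascadeTop hi
  have heS := cascadeRoots_subset S he
  obtain ⟨K, hK, he⟩ := he
  have heL : e ∈ b.posRoots L :=
    b.mem_natSpan_of_add_mem (b.mem_natSpan_univ heS) h (by rw [add_sub_cancel]; exact hiL)
  have hKL : K ⊂ L := by
    refine (he.subset heL).ssubset_of_ne ?_
    rintro rfl
    refine hne (P.root.injective (sub_eq_zero.mp (b.eq_zero_of_mem_natSpan_of_neg_mem h ?_)))
    simpa using b.mem_natSpan_univ (he.sub_mem hiL)
  rw [supportWeight_of_isHighestRoot he, supportWeight_of_isHighestRoot hf]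
  have h1 : K.ncard + 1 ≤ L.ncard := Set.ncard_lt_ncard hKL
  have h2 : 3 ^ (K.ncard + 1) ≤ 3 ^ L.ncard := Nat.pow_le_pow_right (by norm_num) h1
  have h3 : 0 < 3 ^ K.ncard := by positivity
  rw [pow_succ] at h2
  omega

lemma ncard_cascadeRoots (S : Set b.support) : (b.cascadeRoots S).ncard = (b.cascade S).ncard := by
  symm
  refine Set.ncard_congr (fun K (hK : b.InCascade S K) ↦ hK.isConn.exists_isHighestRoot.choose)
    (fun K hK ↦ ⟨K, hK, (InCascade.isConn hK).exists_isHighestRoot.choose_spec⟩) ?_ ?_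
  · intro K L hK hL h
    have h1 := (InCascade.isConn hK).exists_isHighestRoot.choose_spec
    have h2 := (InCascade.isConn hL).exists_isHighestRoot.choose_spec
    exact h1.set_eq (h ▸ h2)
  · rintro e ⟨K, hK, he⟩
    exact ⟨K, hK, hK.isConn.exists_isHighestRoot.choose_spec.unique he⟩

lemma cascadeSpan_eq (S T : Set b.support) :
    b.cascadeSpan S T = Submodule.span K (P.root '' (b.cascadeRoots S ∪ b.cascadeRoots T)) := by
  rw [cascadeSpan]
  congr 1
  ext x
  constructor
  · rintro ⟨K, hK | hK, e, he, rfl⟩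
    · exact ⟨e, Or.inl ⟨K, hK, he⟩, rfl⟩
    · exact ⟨e, Or.inr ⟨K, hK, he⟩, rfl⟩
  · rintro ⟨e, ⟨K, hK, he⟩ | ⟨K, hK, he⟩, rfl⟩
    · exact ⟨K, Or.inl hK, e, he, rfl⟩
    · exact ⟨K, Or.inr hK, e, he, rfl⟩

variable [P.IsReduced]

/-- The pairings of `i` and `j` with `e` add up to 2, and that of `j` is at most 1, so that of `i`
is positive. -/
lemma cascadeTop_eq_of_add_eq {S : Set b.support} {i j e : ι} (hi : i ∈ b.posRoots S)
    (hj : j ∈ b.posRoots S) (he : e ∈ b.cascadeRoots S) (h : P.root i + P.root j = P.root e) :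
    b.cascadeTop S i = e := by
  obtain ⟨K, hK, he⟩ := he
  have hi' := b.mem_natSpan_univ hi
  have hj' := b.mem_natSpan_univ hj
  have hiK : i ∈ b.posRoots K := b.mem_natSpan_of_add_mem hi' hj' (h ▸ he.mem_posRoots)
  have hjK : j ∈ b.posRoots K :=
    b.mem_natSpan_of_add_mem hj' hi' (by rw [add_comm, h]; exact he.mem_posRoots)
  have hje : j ≠ e := by
    rintro rfl
    exact P.ne_zero i (by simpa using h)
  refine IsCascadeTop.cascadeTop_eq ⟨K, hK, he, hiK, ?_⟩
  have h1 := he.pairingIn_le_one hjK hje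
  have h2 := P.pairingIn_eq_add_of_root_eq_add (S := ℤ) (j := e) h.symm
  rw [pairingIn_same] at h2
  omega

lemma pairingIn_cascadeTop {S : Set b.support} {i : ι} (hi : i ∈ b.posRoots S)
    (hne : i ∉ b.cascadeRoots S) : P.pairingIn ℤ i (b.cascadeTop S i) = 1 := by
  obtain ⟨K, hK, he, hiK, hpos⟩ := isCascadeTop_cascadeTop hi
  exact (he.exists_add_eq hiK (fun h ↦ hne (h ▸ cascadeTop_mem hi)) hpos).1

lemma exists_add_eq_cascadeTop {S : Set b.support} {i : ι} (hi : i ∈ b.posRoots S)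
    (hne : i ∉ b.cascadeRoots S) : ∃ j ∈ b.posRoots S, j ∉ b.cascadeRoots S ∧ j ≠ i ∧
      b.cascadeTop S j = b.cascadeTop S i ∧
      P.root i + P.root j = P.root (b.cascadeTop S i) := by
  obtain ⟨K, hK, he, hiK, hpos⟩ := isCascadeTop_cascadeTop hi
  obtain ⟨-, j, hj, hij, -, hje, hji⟩ :=
    he.exists_add_eq hiK (fun h ↦ hne (h ▸ cascadeTop_mem hi)) hpos
  have hjS : j ∈ b.posRoots S := b.natSpan_mono hK.subset hj
  have htop : b.cascadeTop S j = b.cascadeTop S i :=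
    cascadeTop_eq_of_add_eq hjS hi (cascadeTop_mem hi) (by rwa [add_comm])
  refine ⟨j, hjS, fun h ↦ hje ?_, hji, htop, hij⟩
  rw [← htop, cascadeTop_eq_self h]

/-- The map fixing each `ε_K` and exchanging the other roots of a class with their complements in
`ε_K` is an involution, and its fixed points are exactly the `ε_K`. -/
lemma ncard_posRoots_modEq (S : Set b.support) :
    (b.posRoots S).ncard ≡ (b.cascade S).ncard [MOD 2] := by
  classical
  have := Fintype.ofFinite ι
  let f : Function.End (b.posRoots S) := fun i ↦
    if h : i.1 ∈ b.cascadeRoots S then i else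
      ⟨(exists_add_eq_cascadeTop i.2 h).choose, (exists_add_eq_cascadeTop i.2 h).choose_spec.1⟩
  have hf : f ^ 2 ^ 1 = 1 := by
    refine funext fun i ↦ Subtype.ext ?_
    change (f (f i) : ι) = i
    by_cases h : i.1 ∈ b.cascadeRoots S
    · have : f i = i := dif_pos h
      rw [this, this]
    · obtain ⟨hj, hjc, -, htop, hadd⟩ := (exists_add_eq_cascadeTop i.2 h).choose_spec
      have h1 : f i = ⟨(exists_add_eq_cascadeTop i.2 h).choose, hj⟩ := dif_neg h
      rw [h1]
      set j := (exists_add_eq_cascadeTop i.2 h).choose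
      obtain ⟨hk, -, -, -, hadd'⟩ := (exists_add_eq_cascadeTop hj hjc).choose_spec
      have h2 : f ⟨j, hj⟩ = ⟨(exists_add_eq_cascadeTop hj hjc).choose, hk⟩ := dif_neg hjc
      rw [h2]
      refine P.root.injective ?_
      have hadd₂ := hadd'.trans ((congrArg P.root htop).trans (hadd.symm.trans (add_comm _ _)))
      exact add_left_cancel hadd₂
  have hfix : f.fixedPoints = {i | i.1 ∈ b.cascadeRoots S} := by
    ext i
    constructor
    · intro hi
      by_contra h
      have h1 : f i = ⟨(exists_add_eq_cascadeTop i.2 h).choose, _⟩ := dif_neg h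
      have h2 : f i = i := hi
      rw [h1] at h2
      exact (exists_add_eq_cascadeTop i.2 h).choose_spec.2.2.1 (congrArg Subtype.val h2)
    · intro h
      exact dif_pos h
  have key := Equiv.Perm.card_fixedPoints_modEq (p := 2) (n := 1) hf
  rw [← Nat.card_eq_fintype_card, ← Nat.card_eq_fintype_card, hfix] at key
  rw [← ncard_cascadeRoots, ← Nat.card_coe_set_eq]
  convert key using 1
  rw [← Nat.card_coe_set_eq]
  exact Nat.card_congr
    { toFun := fun x ↦ ⟨⟨x.1, cascadeRoots_subset S x.2⟩, x.2⟩
      invFun := fun x ↦ ⟨x.1.1, x.2⟩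
      left_inv := fun _ ↦ rfl
      right_inv := fun _ ↦ rfl }

end CascadeRoots

end RootPairing.Base

/-! ### Linear algebra: semicontinuity of kernels, even rank of alternating forms. -/

open Polynomial in
/-- In a polynomial family of square matrices, the dimension of the kernel does not increase
when passing from the parameter `0` to a general parameter. -/
theorem Matrix.exists_ne_zero_finrank_ker_le {K I : Type*} [Field K] [Infinite K] [Fintype I]
    (A : Matrix I I K[X]) :
    ∃ t : K, t ≠ 0 ∧ finrank K (LinearMap.ker (A.map (eval t)).mulVecLin) ≤
      finrank K (LinearMap.ker (A.map (eval 0)).mulVecLin) := by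
  classical
  set A₀ := (A.map (eval 0)).mulVecLin with hA₀
  obtain ⟨W, hW⟩ := (LinearMap.range A₀).exists_isCompl
  have hfin : finrank K (LinearMap.ker A₀) = finrank K W := by
    have h1 := Submodule.finrank_add_eq_of_isCompl hW
    have h2 := A₀.finrank_range_add_finrank_ker
    omega
  let e : LinearMap.ker A₀ ≃ₗ[K] W := LinearEquiv.ofFinrankEq _ _ hfin
  obtain ⟨p, hp⟩ := (LinearMap.ker A₀).subtype.exists_leftInverse_of_injective
    (LinearMap.ker_eq_bot.mpr (LinearMap.ker A₀).injective_subtype)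
  -- `C` carries `ker A₀` isomorphically onto a complement of the range, which makes `A₀ + C`
  -- invertible.
  let C : (I → K) →ₗ[K] (I → K) := W.subtype ∘ₗ e.toLinearMap ∘ₗ p
  have hinj : LinearMap.ker (A₀ + C) = ⊥ := by
    rw [LinearMap.ker_eq_bot']
    intro v hv
    have h1 : A₀ v = -C v := eq_neg_of_add_eq_zero_left hv
    have h2 : A₀ v = 0 := by
      have : A₀ v ∈ LinearMap.range A₀ ⊓ W := ⟨⟨v, rfl⟩, h1 ▸ neg_mem (e (p v)).2⟩
      rwa [hW.inf_eq_bot, Submodule.mem_bot] at this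
    have h3 : C v = 0 := by rw [h2] at h1; exact neg_eq_zero.mp h1.symm
    have h4 : p v = 0 := e.map_eq_zero_iff.mp (Subtype.ext h3)
    have h5 := LinearMap.congr_fun hp ⟨v, h2⟩
    simp only [LinearMap.comp_apply, Submodule.subtype_apply, LinearMap.id_apply, h4] at h5
    exact congrArg Subtype.val h5.symm
  let C' : Matrix I I K := LinearMap.toMatrix' C
  have hdet : ∀ t : K, (A + C'.map Polynomial.C).det.eval t = (A.map (eval t) + C').det := by
    intro t
    rw [← coe_evalRingHom, RingHom.map_det]
    congr 1
    ext i j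
    simp
  have h0 : (A.map (eval 0) + C').det ≠ 0 := by
    have : (A.map (eval 0) + C').mulVecLin = A₀ + C := by
      rw [Matrix.mulVecLin_add, hA₀, ← Matrix.toLin'_apply' C', Matrix.toLin'_toMatrix']
    rw [← isUnit_iff_ne_zero, ← Matrix.isUnit_iff_isUnit_det, ← Matrix.mulVec_injective_iff_isUnit,
      ← Matrix.coe_mulVecLin, ← LinearMap.ker_eq_bot, this, hinj]
  -- The factor `X` excludes `t = 0` along with the roots of the determinant.
  have hne : (X * (A + C'.map Polynomial.C).det) ≠ 0 := by
    refine mul_ne_zero X_ne_zero fun h ↦ h0 ?_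
    rw [← hdet, h, eval_zero]
  obtain ⟨t, ht⟩ := Infinite.exists_notMem_finset (X * (A + C'.map Polynomial.C).det).roots.toFinset
  rw [Multiset.mem_toFinset, mem_roots hne, IsRoot.def, eval_mul, eval_X, mul_eq_zero, not_or,
    hdet] at ht
  refine ⟨t, ht.1, ?_⟩
  -- Invertibility of `A(t) + C` makes `C` injective on `ker A(t)`, and `C` takes its values in `W`,
  -- of dimension `dim ker A₀`.
  rw [hfin]
  refine LinearMap.finrank_le_finrank_of_injective
    (f := (e.toLinearMap ∘ₗ p) ∘ₗ (LinearMap.ker (A.map (eval t)).mulVecLin).subtype) ?_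
  rw [← LinearMap.ker_eq_bot, LinearMap.ker_eq_bot']
  rintro ⟨v, hv⟩ hCv
  have hCv' : C v = 0 := congrArg Subtype.val hCv
  have h1 : (A.map (eval t) + C').mulVec v = 0 := by
    rw [Matrix.add_mulVec, ← Matrix.toLin'_apply C', Matrix.toLin'_toMatrix', hCv', add_zero]
    exact hv
  exact Subtype.ext (Matrix.eq_zero_of_mulVec_eq_zero ht.2 h1)

/-- On a complement of the kernel the Gram matrix is skew with non-zero determinant, so `det A =
(-1)^n det A` forces the size `n` to be even. -/
theorem LinearMap.BilinForm.IsAlt.finrank_modEq {K V : Type*} [Field K] [CharZero K]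
    [AddCommGroup V] [Module K V] [FiniteDimensional K V] {B : LinearMap.BilinForm K V}
    (hB : B.IsAlt) : finrank K V ≡ finrank K (LinearMap.ker B) [MOD 2] := by
  classical
  obtain ⟨W, hW⟩ := (LinearMap.ker B).exists_isCompl
  have hskew : ∀ x y, B x y = -B y x := fun x y ↦ by
    rw [LinearMap.BilinForm.IsAlt.neg_eq hB]
  let β := finBasis K W
  let A : Matrix (Fin (finrank K W)) (Fin (finrank K W)) K := Matrix.of fun i j ↦ B (β i) (β j)
  have hA : A.transpose = -A := by
    ext i j
    exact hskew _ _
  have hdet : A.det ≠ 0 := by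
    intro h
    obtain ⟨v, hv, hv0⟩ := Matrix.exists_vecMul_eq_zero_iff.mpr h
    set w : W := ∑ i, v i • β i with hw
    have h1 : ∀ j, B w (β j) = 0 := by
      intro j
      have := congrFun hv0 j
      simpa [Matrix.vecMul, dotProduct, A, hw] using this
    have h2 : ∀ u : W, B w u = 0 := by
      intro u
      have : B w ∘ₗ W.subtype = 0 := β.ext fun j ↦ h1 j
      exact LinearMap.congr_fun this u
    have h3 : (w : V) ∈ LinearMap.ker B ⊓ W := by
      refine ⟨?_, w.2⟩
      refine LinearMap.mem_ker.mpr (LinearMap.ext fun u ↦ ?_)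
      obtain ⟨x, hx, y, hy, rfl⟩ := Submodule.mem_sup.mp
        (hW.sup_eq_top ▸ Submodule.mem_top : u ∈ LinearMap.ker B ⊔ W)
      rw [map_add, h2 ⟨y, hy⟩, hskew, LinearMap.mem_ker.mp hx]
      simp
    rw [hW.inf_eq_bot, Submodule.mem_bot] at h3
    have h4 : w = 0 := Subtype.ext h3
    refine hv (funext fun i ↦ ?_)
    exact (Fintype.linearIndependent_iff.mp β.linearIndependent) v (hw ▸ h4) i
  have heven : Even (finrank K W) := by
    have h1 := congrArg Matrix.det hA
    rw [Matrix.det_transpose, Matrix.det_neg, Fintype.card_fin] at h1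
    by_contra h
    rw [(Nat.not_even_iff_odd.mp h).neg_one_pow, neg_one_mul, self_eq_neg] at h1
    exact hdet h1
  have h := Submodule.finrank_add_eq_of_isCompl hW
  rw [Nat.ModEq, ← h]
  have := Nat.even_iff.mp heven
  omega

/-! ### The forms `Φ_f` and the parity of the index. -/

namespace LieAlgebra

variable {K A : Type*} [Field K] [CharZero K] [LieRing A] [LieAlgebra K A] [FiniteDimensional K A]

lemma kirillovForm_apply (f : Dual K A) (x y : A) : kirillovForm f x y = f ⁅x, y⁆ := rfl

lemma isAlt_kirillovForm (f : Dual K A) : (kirillovForm f).IsAlt := fun x ↦ by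
  rw [kirillovForm_apply, lie_self, map_zero]

variable (K A) in
lemma finrank_modEq_index : finrank K A ≡ index K A [MOD 2] := by
  obtain ⟨f, hf⟩ := Nat.sInf_mem
    (Set.range_nonempty fun f : Dual K A ↦ finrank K (LinearMap.ker (kirillovForm f)))
  have : index K A = finrank K (LinearMap.ker (kirillovForm f)) := hf.symm
  rw [this]
  exact (isAlt_kirillovForm f).finrank_modEq

lemma index_le (f : Dual K A) : index K A ≤ finrank K (LinearMap.ker (kirillovForm f)) :=
  Nat.sInf_le ⟨f, rfl⟩

end LieAlgebra

namespace LieAlgebra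

open LieAlgebra.IsKilling LieModule

/-! ### Root vectors, dual linear forms and non-vanishing brackets. -/

section RootVector

variable {K L : Type*} [Field K] [CharZero K] [IsAlgClosed K] [LieRing L] [LieAlgebra K L]
  [FiniteDimensional K L] [LieAlgebra.IsSemisimple K L]
  {H : LieSubalgebra K L} [H.IsCartanSubalgebra]

/-- A non-zero vector of the weight space of `χ`. -/
def rootVector (χ : Weight K H L) : L := χ.exists_ne_zero.choose

lemma rootVector_mem (χ : Weight K H L) : rootVector χ ∈ rootSpace H χ :=
  χ.exists_ne_zero.choose_spec.1

lemma rootVector_ne_zero (χ : Weight K H L) : rootVector χ ≠ 0 :=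
  χ.exists_ne_zero.choose_spec.2

lemma rootSpace_eq_span_rootVector {χ : Weight K H L} (hχ : χ.IsNonZero) :
    (rootSpace H χ).toSubmodule = Submodule.span K {rootVector χ} := by
  have h := finrank_rootSpace_eq_one χ hχ
  refine le_antisymm (fun x hx ↦ ?_) ?_
  · obtain ⟨c, hc⟩ := (finrank_eq_one_iff_of_nonzero' (⟨rootVector χ, rootVector_mem χ⟩ :
      rootSpace H χ) (fun h ↦ rootVector_ne_zero χ (congrArg Subtype.val h))).mp h ⟨x, hx⟩
    exact Submodule.mem_span_singleton.mpr ⟨c, congrArg Subtype.val hc⟩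
  · rw [Submodule.span_singleton_le_iff_mem]
    exact rootVector_mem χ

lemma killingForm_ne_zero_of_mem_rootSpace {χ : Weight K H L} (hχ : χ.IsNonZero) {x y : L}
    (hx : x ∈ rootSpace H (-χ : H → K)) (hy : y ∈ rootSpace H χ) (hx0 : x ≠ 0) (hy0 : y ≠ 0) :
    killingForm K L x y ≠ 0 := by
  intro h
  refine hx0 ?_
  have hker := mem_ker_killingForm_of_mem_rootSpace_of_forall_rootSpace_neg K L H hx (by
    intro z hz
    rw [neg_neg] at hz
    obtain ⟨c, hc⟩ := (finrank_eq_one_iff_of_nonzero' (⟨y, hy⟩ : rootSpace H χ)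
      (fun h ↦ hy0 (congrArg Subtype.val h))).mp (finrank_rootSpace_eq_one χ hχ) ⟨z, hz⟩
    have hc' : c • y = z := congrArg Subtype.val hc
    rw [← hc', map_smul, h, smul_zero])
  simpa using hker

/-- The linear form on `𝔤` which is non-zero on the root space of `χ` and vanishes on the other
ones. -/
def rootForm (χ : Weight K H L) : Dual K L := killingForm K L (rootVector (-χ))

lemma rootForm_eq_zero_of_mem {χ : Weight K H L} {ψ : H → K} {x : L} (hx : x ∈ rootSpace H ψ)
    (h : ψ ≠ χ) : rootForm χ x = 0 :=
  killingForm_apply_eq_zero_of_mem_rootSpace_of_add_ne_zero K L H (rootVector_mem (-χ)) hx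
    fun h' ↦ h (by rw [Weight.coe_neg, neg_add_eq_zero] at h'; exact h'.symm)

lemma rootForm_rootVector_ne_zero {χ : Weight K H L} (hχ : χ.IsNonZero) :
    rootForm χ (rootVector χ) ≠ 0 :=
  killingForm_ne_zero_of_mem_rootSpace hχ (rootVector_mem (-χ)) (rootVector_mem χ)
    (rootVector_ne_zero _) (rootVector_ne_zero _)

lemma apply_cartanEquivDual_symm_ne_zero {α ε : Weight K H L} (h : α (coroot ε) ≠ 0) :
    α ((cartanEquivDual H).symm ε) ≠ 0 := by
  intro h'
  apply h
  rw [← Weight.toLinear_apply] at h' ⊢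
  rw [coroot, map_nsmul, map_smul, h', smul_zero, smul_zero]

/-- By invariance of the Killing form the value is that of `[y, e_α]` against `e_β`, with `y` of
weight `-ε`, so it suffices that `[y, e_α] ≠ 0`. As `[e_ε, e_α] = 0`, the Jacobi identity shows that
`ad e_ε` sends it to `[[e_ε, y], e_α]`, a non-zero multiple of `e_α` because `α` does not vanish on
the coroot of `ε`. -/
lemma rootForm_lie_rootVector_ne_zero {α β ε : Weight K H L} (hβ : β.IsNonZero)
    (hε : ε.IsNonZero) (h : (α + β : H → K) = ε) (hαε : rootSpace H (α + ε : H → K) = ⊥)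
    (hpair : α (coroot ε) ≠ 0) : rootForm ε ⁅rootVector α, rootVector β⁆ ≠ 0 := by
  set y := rootVector (-ε) with hy
  have hz : ⁅y, rootVector α⁆ ∈ rootSpace H (-β : H → K) := by
    have : (-β : H → K) = ((-ε : Weight K H L) : H → K) + α := by
      rw [Weight.coe_neg, ← h]; abel
    rw [this]
    exact lie_mem_genWeightSpace_of_mem_genWeightSpace (rootVector_mem _) (rootVector_mem _)
  have hz0 : ⁅y, rootVector α⁆ ≠ 0 := by
    intro h0
    have h1 : ⁅rootVector ε, rootVector α⁆ = 0 := by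
      have : ⁅rootVector ε, rootVector α⁆ ∈ rootSpace H (ε + α : H → K) :=
        lie_mem_genWeightSpace_of_mem_genWeightSpace (rootVector_mem _) (rootVector_mem _)
      rw [add_comm, hαε] at this
      simpa using this
    have h2 : ⁅rootVector ε, y⁆ =
        ((killingForm K L (rootVector ε) y • (cartanEquivDual H).symm ε : H) : L) :=
      lie_eq_killingForm_smul_of_mem_rootSpace_of_mem_rootSpace_neg (rootVector_mem ε)
        (rootVector_mem (-ε))
    have h3 := leibniz_lie (rootVector ε) y (rootVector α)
    rw [h0, h1, lie_zero, lie_zero, add_zero, h2] at h3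
    have h4 := lie_eq_smul_of_mem_rootSpace (rootVector_mem α)
      (killingForm K L (rootVector ε) y • (cartanEquivDual H).symm ε)
    have h5 : α (killingForm K L (rootVector ε) y • (cartanEquivDual H).symm ε) ≠ 0 := by
      rw [← Weight.toLinear_apply, map_smul, smul_eq_mul]
      refine mul_ne_zero ?_ (apply_cartanEquivDual_symm_ne_zero hpair)
      rw [LieModule.traceForm_comm]
      exact killingForm_ne_zero_of_mem_rootSpace hε (rootVector_mem (-ε)) (rootVector_mem ε)
        (rootVector_ne_zero _) (rootVector_ne_zero _)
    exact smul_ne_zero h5 (rootVector_ne_zero α) (h4.symm.trans h3.symm)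
  have := killingForm_ne_zero_of_mem_rootSpace hβ hz (rootVector_mem β) hz0 (rootVector_ne_zero β)
  rwa [LieModule.traceForm_apply_lie_apply] at this

end RootVector

end LieAlgebra

namespace LieAlgebra

open LieAlgebra.IsKilling LieModule

/-! ### Roots of the seaweed algebra, their tops and the scaling exponents. -/

section SeaweedRoot

variable {K L : Type*} [Field K] [CharZero K] [IsAlgClosed K] [LieRing L] [LieAlgebra K L]
  [FiniteDimensional K L] [LieAlgebra.IsSemisimple K L]
  {H : LieSubalgebra K L} [H.IsCartanSubalgebra]

lemma rootSpace_add_eq_bot {α β : H.root}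
    (h : (rootSystem H).root α + (rootSystem H).root β ∉ Set.range (rootSystem H).root)
    (h0 : (rootSystem H).root α + (rootSystem H).root β ≠ 0) :
    rootSpace H (α.1 + β.1 : H → K) = ⊥ := by
  by_contra hbot
  let γ : Weight K H L := ⟨α.1 + β.1, hbot⟩
  have hγ : γ ∈ H.root := by
    have hnz : γ.IsNonZero := fun hz ↦ h0 (by
      ext x
      exact congrFun hz x)
    simpa [LieSubalgebra.root] using hnz
  refine h ⟨⟨γ, hγ⟩, ?_⟩
  ext x
  rfl

variable (b : (rootSystem H).Base) (S T : Set b.support)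

/-- The roots of `𝔤_{S,T}`: an element of `R^S_+`, or the opposite of an element of `R^T_+`. -/
abbrev SeaweedRoot := b.posRoots S ⊕ b.posRoots T

namespace SeaweedRoot

variable {b S T}

/-- The root itself. -/
def weight : SeaweedRoot b S T → Weight K H L := Sum.elim (fun α ↦ α.1.1) (fun β ↦ -β.1.1)

/-- The root itself, as a linear form. -/
def linear : SeaweedRoot b S T → Dual K H :=
  Sum.elim (fun α ↦ (rootSystem H).root α.1) (fun β ↦ -(rootSystem H).root β.1)

/-- The root is `± ε_K` for some `K ∈ 𝒦(S)`, resp. `K ∈ 𝒦(T)`. -/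
def IsTop : SeaweedRoot b S T → Prop :=
  Sum.elim (fun α ↦ α.1 ∈ b.cascadeRoots S) (fun β ↦ β.1 ∈ b.cascadeRoots T)

/-- The root `± ε_K` attached to a root. -/
def top : SeaweedRoot b S T → SeaweedRoot b S T :=
  Sum.map
    (fun α ↦ ⟨b.cascadeTop S α.1, b.cascadeRoots_subset S (b.cascadeTop_mem α.2)⟩)
    (fun β ↦ ⟨b.cascadeTop T β.1, b.cascadeRoots_subset T (b.cascadeTop_mem β.2)⟩)

/-- The weight of `± ε_K`. -/
def size : SeaweedRoot b S T → ℕ :=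
  Sum.elim (fun α ↦ b.supportWeight α.1) (fun β ↦ b.supportWeight β.1)

open Classical in
/-- The exponent used to rescale a root vector. -/
def scale (i : SeaweedRoot b S T) : ℕ := if i.IsTop then 2 * i.size else i.top.size

lemma coe_linear (i : SeaweedRoot b S T) (x : H) : i.linear x = i.weight x := by
  rcases i with α | β <;> rfl

lemma weight_isNonZero (i : SeaweedRoot b S T) : i.weight.IsNonZero := by
  rcases i with α | β
  · exact LieSubalgebra.isNonZero_coe_root α.1
  · exact (LieSubalgebra.isNonZero_coe_root β.1).neg

lemma linear_eq_of_coe_eq {i j k : SeaweedRoot b S T}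
    (h : (i.weight + j.weight : H → K) = k.weight) : i.linear + j.linear = k.linear := by
  ext x
  rw [LinearMap.add_apply, coe_linear, coe_linear, coe_linear]
  exact congrFun h x

lemma coe_eq_of_linear_eq {i j k : SeaweedRoot b S T} (h : i.linear + j.linear = k.linear) :
    (i.weight + j.weight : H → K) = k.weight := by
  ext x
  have := LinearMap.congr_fun h x
  rw [LinearMap.add_apply, coe_linear, coe_linear, coe_linear] at this
  exact this

lemma linear_injective : Function.Injective (linear : SeaweedRoot b S T → Dual K H) := by
  have key : ∀ (α : b.posRoots S) (β : b.posRoots T),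
      (rootSystem H).root α.1 ≠ -(rootSystem H).root β.1 := by
    intro α β h
    exact (rootSystem H).ne_zero β.1 (b.eq_zero_of_mem_natSpan_of_neg_mem
      (b.mem_natSpan_univ β.2) (h ▸ b.mem_natSpan_univ α.2))
  rintro (α | α) (β | β) h
  · exact congrArg Sum.inl (Subtype.ext ((rootSystem H).root.injective h))
  · exact (key α β h).elim
  · exact (key β α h.symm).elim
  · exact congrArg Sum.inr (Subtype.ext ((rootSystem H).root.injective (neg_injective h)))

lemma weight_injective : Function.Injective (weight : SeaweedRoot b S T → Weight K H L) :=
  fun i j h ↦ linear_injective (LinearMap.ext fun x ↦ by rw [coe_linear, coe_linear, h])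

lemma top_eq_self {i : SeaweedRoot b S T} (hi : i.IsTop) : i.top = i := by
  rcases i with α | β
  · exact congrArg Sum.inl (Subtype.ext (b.cascadeTop_eq_self hi))
  · exact congrArg Sum.inr (Subtype.ext (b.cascadeTop_eq_self hi))

lemma isTop_top (i : SeaweedRoot b S T) : i.top.IsTop := by
  rcases i with α | β
  · exact b.cascadeTop_mem α.2
  · exact b.cascadeTop_mem β.2

lemma scale_of_isTop {i : SeaweedRoot b S T} (hi : i.IsTop) : i.scale = 2 * i.size := if_pos hi

lemma scale_of_not_isTop {i : SeaweedRoot b S T} (hi : ¬ i.IsTop) : i.scale = i.top.size :=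
  if_neg hi

lemma size_top_le_scale (i : SeaweedRoot b S T) : i.top.size ≤ i.scale := by
  by_cases hi : i.IsTop
  · rw [scale_of_isTop hi, top_eq_self hi]
    omega
  · rw [scale_of_not_isTop hi]

lemma isTop_eq_of_top_eq {i γ : SeaweedRoot b S T} (h : i.top = γ) (hi : i.IsTop) : i = γ := by
  rw [← h, top_eq_self hi]

lemma linear_ne_zero (i : SeaweedRoot b S T) : i.linear ≠ 0 := by
  rcases i with α | β
  · exact (rootSystem H).ne_zero α.1
  · exact neg_ne_zero.mpr ((rootSystem H).ne_zero β.1)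

/-- If `α - β` is a positive top, that top is strictly below `α`; if it is a negative one, its
opposite is strictly below `β`. Either way `two_mul_supportWeight_lt` applies. -/
lemma two_mul_size_lt_or_top_eq_aux (α : b.posRoots S) (β : b.posRoots T) {γ : SeaweedRoot b S T}
    (hγ : γ.IsTop) (h : (rootSystem H).root α.1 - (rootSystem H).root β.1 = γ.linear) :
    2 * γ.size < scale (Sum.inl α : SeaweedRoot b S T) ∨
      2 * γ.size < scale (Sum.inr β : SeaweedRoot b S T) := by
  rcases γ with γ | γ
  · left
    replace h : (rootSystem H).root α.1 - (rootSystem H).root β.1 = (rootSystem H).root γ.1 := h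
    refine lt_of_lt_of_le ?_ (size_top_le_scale _)
    refine b.two_mul_supportWeight_lt α.2 hγ ?_ ?_
    · rw [← h, sub_sub_cancel]
      exact b.mem_natSpan_univ β.2
    · intro h'
      rw [h', sub_eq_self] at h
      exact (rootSystem H).ne_zero β.1 h
  · right
    replace h : (rootSystem H).root α.1 - (rootSystem H).root β.1 = -(rootSystem H).root γ.1 := h
    refine lt_of_lt_of_le ?_ (size_top_le_scale _)
    refine b.two_mul_supportWeight_lt β.2 hγ ?_ ?_
    · rw [← neg_neg ((rootSystem H).root γ.1), ← h, sub_neg_eq_add, add_sub_cancel]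
      exact b.mem_natSpan_univ α.2
    · intro h'
      rw [h', sub_eq_neg_self] at h
      exact (rootSystem H).ne_zero α.1 h

/-- This separates the wanted brackets from the unwanted ones. Two roots of the same sign with sum a
top both belong to its class; for opposite signs the scaling exponents strictly exceed `2 * γ.size`,
and the entry dies at `t = 0`. -/
lemma two_mul_size_lt_or_top_eq {i j γ : SeaweedRoot b S T} (hγ : γ.IsTop)
    (h : i.linear + j.linear = γ.linear) :
    2 * γ.size < i.scale + j.scale ∨ i.top = γ ∧ j.top = γ := by
  have key : ∀ α β γ : H.root, (rootSystem H).root α ∈ b.natSpan Set.univ →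
      (rootSystem H).root β ∈ b.natSpan Set.univ → (rootSystem H).root γ ∈ b.natSpan Set.univ →
      (rootSystem H).root α + (rootSystem H).root β ≠ -(rootSystem H).root γ := by
    intro α β γ hα hβ hγ h
    exact (rootSystem H).ne_zero γ (b.eq_zero_of_mem_natSpan_of_neg_mem hγ (h ▸ add_mem hα hβ))
  rcases i with α | α <;> rcases j with β | β
  · rcases γ with γ | γ
    · right
      replace h : (rootSystem H).root α.1 + (rootSystem H).root β.1 = (rootSystem H).root γ.1 := h
      exact ⟨congrArg Sum.inl (Subtype.ext (b.cascadeTop_eq_of_add_eq α.2 β.2 hγ h)),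
        congrArg Sum.inl (Subtype.ext (b.cascadeTop_eq_of_add_eq β.2 α.2 hγ
          (by rwa [add_comm])))⟩
    · exact (key _ _ _ (b.mem_natSpan_univ α.2) (b.mem_natSpan_univ β.2)
        (b.mem_natSpan_univ γ.2) h).elim
  · left
    have := two_mul_size_lt_or_top_eq_aux α β hγ ((sub_eq_add_neg _ _).trans h)
    omega
  · left
    have := two_mul_size_lt_or_top_eq_aux β α hγ ((neg_add_eq_sub _ _).symm.trans h)
    omega
  · rcases γ with γ | γ
    · refine (key _ _ _ (b.mem_natSpan_univ α.2) (b.mem_natSpan_univ β.2)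
        (b.mem_natSpan_univ γ.2) ?_).elim
      replace h : -(rootSystem H).root α.1 + -(rootSystem H).root β.1 =
        (rootSystem H).root γ.1 := h
      rw [← h]
      abel
    · right
      replace h : (rootSystem H).root α.1 + (rootSystem H).root β.1 = (rootSystem H).root γ.1 := by
        have h' : -(rootSystem H).root α.1 + -(rootSystem H).root β.1 =
          -(rootSystem H).root γ.1 := h
        rw [← neg_inj, ← h']
        abel
      exact ⟨congrArg Sum.inr (Subtype.ext (b.cascadeTop_eq_of_add_eq α.2 β.2 hγ h)),
        congrArg Sum.inr (Subtype.ext (b.cascadeTop_eq_of_add_eq β.2 α.2 hγ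
          (by rwa [add_comm])))⟩

lemma not_isTop_of_add_eq {i j γ : SeaweedRoot b S T} (h : i.linear + j.linear = γ.linear)
    (hi : i.top = γ) : ¬ i.IsTop := fun h' ↦ by
  rw [isTop_eq_of_top_eq hi h', add_eq_left] at h
  exact j.linear_ne_zero h

/-- A root `i` which is not of the form `± ε_K` has a partner `j` such that `i + j = ± ε_K`. -/
lemma exists_partner {i : SeaweedRoot b S T} (hi : ¬ i.IsTop) :
    ∃ j : SeaweedRoot b S T, ¬ j.IsTop ∧ j.top = i.top ∧ i.linear + j.linear = i.top.linear ∧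
      rootForm i.top.weight ⁅rootVector i.weight, rootVector j.weight⁆ ≠ 0 := by
  rcases i with α | α
  · obtain ⟨β, hβ, hβ', -, htop, hadd⟩ := b.exists_add_eq_cascadeTop α.2 hi
    have hl : linear (Sum.inl α : SeaweedRoot b S T) +
      linear (Sum.inl ⟨β, hβ⟩ : SeaweedRoot b S T) =
      (top (Sum.inl α : SeaweedRoot b S T)).linear := hadd
    refine ⟨Sum.inl ⟨β, hβ⟩, hβ', congrArg Sum.inl (Subtype.ext htop), hl, ?_⟩
    refine rootForm_lie_rootVector_ne_zero (weight_isNonZero _) (weight_isNonZero _)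
      (coe_eq_of_linear_eq hl) (rootSpace_add_eq_bot (b.root_add_cascadeTop_notMem α.2) ?_) ?_
    · intro h0
      refine (rootSystem H).ne_zero α.1 (b.eq_zero_of_mem_natSpan_of_neg_mem
        (b.mem_natSpan_univ α.2) ?_)
      rw [neg_eq_of_add_eq_zero_right h0]
      exact b.mem_natSpan_univ (b.cascadeRoots_subset S (b.cascadeTop_mem α.2))
    · have h1 := b.pairingIn_cascadeTop α.2 hi
      have h2 : (rootSystem H).pairing α.1 (b.cascadeTop S α.1) = 1 := by
        rw [← (rootSystem H).algebraMap_pairingIn ℤ, h1, map_one]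
      rw [rootSystem_pairing_apply] at h2
      exact h2.symm ▸ one_ne_zero
  · obtain ⟨β, hβ, hβ', -, htop, hadd⟩ := b.exists_add_eq_cascadeTop α.2 hi
    have hl : linear (Sum.inr α : SeaweedRoot b S T) + linear (Sum.inr ⟨β, hβ⟩ : SeaweedRoot b S T) =
        (top (Sum.inr α : SeaweedRoot b S T)).linear := by
      change -(rootSystem H).root α.1 + -(rootSystem H).root β =
        -(rootSystem H).root (b.cascadeTop T α.1)
      rw [← hadd]
      abel
    refine ⟨Sum.inr ⟨β, hβ⟩, hβ', congrArg Sum.inr (Subtype.ext htop), hl, ?_⟩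
    refine rootForm_lie_rootVector_ne_zero (weight_isNonZero _) (weight_isNonZero _)
      (coe_eq_of_linear_eq hl) ?_ ?_
    · have h0 : rootSpace H (α.1.1 + (b.cascadeTop T α.1).1 : H → K) = ⊥ := by
        refine rootSpace_add_eq_bot (b.root_add_cascadeTop_notMem α.2) ?_
        intro h0
        refine (rootSystem H).ne_zero α.1 (b.eq_zero_of_mem_natSpan_of_neg_mem
          (b.mem_natSpan_univ α.2) ?_)
        rw [neg_eq_of_add_eq_zero_right h0]
        exact b.mem_natSpan_univ (b.cascadeRoots_subset T (b.cascadeTop_mem α.2))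
      -- Weights are stable under negation, so the sum `-α - ε` is excluded because `α + ε` is.
      by_contra hbot
      let χ : Weight K H L := ⟨_, hbot⟩
      have hne : rootSpace H ((-χ : Weight K H L) : H → K) ≠ ⊥ := (-χ).2
      refine hne ?_
      convert h0 using 2
      change -((-α.1.1 : H → K) + -(b.cascadeTop T α.1).1) = _
      abel
    · have h1 := b.pairingIn_cascadeTop α.2 hi
      have h2 : (rootSystem H).pairing α.1 (b.cascadeTop T α.1) = 1 := by
        rw [← (rootSystem H).algebraMap_pairingIn ℤ, h1, map_one]
      rw [rootSystem_pairing_apply] at h2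
      change (-α.1.1) (coroot (-(b.cascadeTop T α.1).1)) ≠ 0
      rw [coroot_neg, ← Weight.toLinear_apply, map_neg, Weight.toLinear_apply, Weight.coe_neg,
        Pi.neg_apply, h2, neg_neg]
      exact one_ne_zero

end SeaweedRoot

end SeaweedRoot

end LieAlgebra

namespace LieAlgebra

open LieAlgebra.IsKilling LieModule

/-! ### A basis adapted to the root decomposition, and the dimension. -/

section SeaweedBasis

variable {K L : Type*} [Field K] [CharZero K] [IsAlgClosed K] [LieRing L] [LieAlgebra K L]
  [FiniteDimensional K L] [LieAlgebra.IsSemisimple K L]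
  {H : LieSubalgebra K L} [H.IsCartanSubalgebra]

variable (b : (rootSystem H).Base) (S T : Set b.support)

instance : Fintype (b.posRoots S) := Fintype.ofFinite _

lemma coe_mem_rootSpace_zero (h : H) : (h : L) ∈ rootSpace H (0 : H → K) := by
  have hH : H.toSubmodule = (rootSpace H (0 : H → K)).toSubmodule := by simp
  rw [← LieSubmodule.mem_toSubmodule, ← hH]
  exact h.2

/-- The indices of a basis of `𝔤_{S,T}`. -/
abbrev SeaweedIndex := Fin (finrank K H) ⊕ SeaweedRoot b S T

variable {b S T}

/-- A basis of `𝔤_{S,T}`, as a family of elements of `𝔤`. -/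
def seaweedVector : SeaweedIndex b S T → L :=
  Sum.elim (fun h ↦ (finBasis K H h : L)) (fun i ↦ rootVector i.weight)

/-- The weights of the elements of the basis of `𝔤_{S,T}`. -/
def seaweedWeight : SeaweedIndex b S T → H → K :=
  Sum.elim (fun _ ↦ 0) (fun i ↦ i.weight)

lemma seaweedVector_mem_rootSpace (i : SeaweedIndex b S T) :
    seaweedVector i ∈ rootSpace H (seaweedWeight i) := by
  rcases i with h | i
  · exact coe_mem_rootSpace_zero _
  · exact rootVector_mem i.weight

lemma rootForm_seaweedVector_inr_of_ne {i j : SeaweedRoot b S T} (h : i ≠ j) :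
    rootForm i.weight (seaweedVector (Sum.inr j : SeaweedIndex b S T)) = 0 :=
  rootForm_eq_zero_of_mem (rootVector_mem j.weight)
    fun h' ↦ h (SeaweedRoot.weight_injective (DFunLike.coe_injective h'.symm))

lemma rootForm_coe (i : SeaweedRoot b S T) (h : H) : rootForm i.weight (h : L) = 0 :=
  rootForm_eq_zero_of_mem (coe_mem_rootSpace_zero h) fun h' ↦ i.weight_isNonZero h'.symm

variable (b S T) in
-- Each `rootForm` isolates the coefficient of one root vector; what remains is a relation in a
-- basis of `𝔥`.
lemma linearIndependent_seaweedVector :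
    LinearIndependent K (seaweedVector : SeaweedIndex b S T → L) := by
  rw [Fintype.linearIndependent_iff]
  intro g hg
  have hr : ∀ k, g (Sum.inr k) = 0 := by
    intro k
    have h := congrArg (rootForm k.weight) hg
    rw [map_sum, map_zero, Fintype.sum_sum_type, Finset.sum_eq_zero, zero_add,
      Finset.sum_eq_single k] at h
    · rw [map_smul] at h
      exact (smul_eq_zero.mp h).resolve_right (rootForm_rootVector_ne_zero k.weight_isNonZero)
    · intro j _ hj
      rw [map_smul, rootForm_seaweedVector_inr_of_ne hj.symm, smul_zero]
    · simp
    · intro j _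
      rw [map_smul]
      exact smul_eq_zero_of_right _ (rootForm_coe k _)
  have hl : ∀ k, g (Sum.inl k) = 0 := by
    refine Fintype.linearIndependent_iff.mp (finBasis K H).linearIndependent _ ?_
    rw [Fintype.sum_sum_type, Finset.sum_eq_zero (s := Finset.univ (α := SeaweedRoot b S T)),
      add_zero] at hg
    · refine Subtype.ext ?_
      refine Eq.trans ?_ hg
      simp [seaweedVector]
    · intro k _
      rw [hr, zero_smul]
  rintro (k | k)
  · exact hl k
  · exact hr k

lemma root_reflectionPerm_self (α : H.root) :
    (rootSystem H).root ((rootSystem H).reflectionPerm α α) = -(rootSystem H).root α := by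
  rw [RootPairing.root_reflectionPerm, RootPairing.reflection_apply_self]

lemma neg_reflectionPerm_self (α : H.root) :
    -((rootSystem H).reflectionPerm α α).1 = α.1 := by
  have h : (rootSystem H).root ((rootSystem H).reflectionPerm α α) = -(rootSystem H).root α :=
    root_reflectionPerm_self α
  ext x
  have hx := LinearMap.congr_fun h x
  change -(((rootSystem H).reflectionPerm α α).1 x) = α.1 x
  rw [neg_eq_iff_eq_neg]
  exact hx

variable (b S T) in
lemma span_seaweedVector :
    Submodule.span K (Set.range (seaweedVector : SeaweedIndex b S T → L)) =
      (seaweed b S T).toSubmodule := by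
  have hle : ∀ i : SeaweedRoot b S T, (rootSpace H i.weight).toSubmodule ≤
      Submodule.span K (Set.range (seaweedVector : SeaweedIndex b S T → L)) := by
    intro i
    rw [rootSpace_eq_span_rootVector i.weight_isNonZero, Submodule.span_singleton_le_iff_mem]
    exact Submodule.subset_span ⟨Sum.inr i, rfl⟩
  have hneg : ∀ β : H.root, β ∈ b.posRoots T →
      ((rootSystem H).reflectionPerm β β) ∈ b.negRoots T := by
    intro β hβ
    change -(rootSystem H).root ((rootSystem H).reflectionPerm β β) ∈ b.natSpan T
    rw [root_reflectionPerm_self, neg_neg]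
    exact hβ
  have hpos : ∀ β : H.root, β ∈ b.negRoots T →
      ((rootSystem H).reflectionPerm β β) ∈ b.posRoots T := by
    intro β hβ
    change (rootSystem H).root ((rootSystem H).reflectionPerm β β) ∈ b.natSpan T
    rw [root_reflectionPerm_self]
    exact hβ
  change _ = H.toSubmodule ⊔ (⨆ α ∈ b.posRoots S, (rootSpace H α.1).toSubmodule) ⊔
    (⨆ α ∈ b.negRoots T, (rootSpace H α.1).toSubmodule)
  refine le_antisymm ?_ (sup_le (sup_le ?_ ?_) ?_)
  · rw [Submodule.span_le]
    rintro - ⟨h | α | β, rfl⟩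
    · exact Submodule.mem_sup_left (Submodule.mem_sup_left (finBasis K H h).2)
    · exact Submodule.mem_sup_left (Submodule.mem_sup_right
        (Submodule.mem_iSup_of_mem α.1 (Submodule.mem_iSup_of_mem α.2 (rootVector_mem _))))
    · refine Submodule.mem_sup_right (Submodule.mem_iSup_of_mem
        ((rootSystem H).reflectionPerm β.1 β.1) (Submodule.mem_iSup_of_mem (hneg _ β.2) ?_))
      rw [← neg_neg ((rootSystem H).reflectionPerm β.1 β.1).1, neg_reflectionPerm_self]
      exact rootVector_mem _
  · intro x hx
    have h := congrArg Subtype.val ((finBasis K H).sum_repr ⟨x, hx⟩)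
    rw [← show _ = x from h, AddSubmonoidClass.coe_finsetSum]
    exact sum_mem fun i _ ↦ Submodule.smul_mem _ _ (Submodule.subset_span ⟨Sum.inl i, rfl⟩)
  · exact iSup₂_le fun α hα ↦ hle (Sum.inl ⟨α, hα⟩)
  · refine iSup₂_le fun α hα ↦ ?_
    have := hle (Sum.inr ⟨_, hpos α hα⟩)
    rwa [show SeaweedRoot.weight (Sum.inr ⟨_, hpos α hα⟩ : SeaweedRoot b S T) = α.1 from
      neg_reflectionPerm_self α] at this

lemma seaweedVector_mem (i : SeaweedIndex b S T) : seaweedVector i ∈ seaweed b S T := by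
  rw [← LieSubalgebra.mem_toSubmodule, ← span_seaweedVector]
  exact Submodule.subset_span ⟨i, rfl⟩

variable (b S T) in
/-- A basis of `𝔤_{S,T}` adapted to the root space decomposition. -/
def seaweedBasis : Module.Basis (SeaweedIndex b S T) K (seaweed b S T) :=
  Module.Basis.mk (v := fun i ↦ ⟨seaweedVector i, seaweedVector_mem i⟩)
    (LinearIndependent.of_comp (seaweed b S T).toSubmodule.subtype
      (linearIndependent_seaweedVector b S T))
    (by
      rintro ⟨x, hx⟩ -
      rw [← LieSubalgebra.mem_toSubmodule, ← span_seaweedVector] at hx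
      have hmap : Submodule.map (seaweed b S T).toSubmodule.subtype (Submodule.span K (Set.range
          fun i : SeaweedIndex b S T ↦ (⟨seaweedVector i, seaweedVector_mem i⟩ : seaweed b S T))) =
          Submodule.span K (Set.range (seaweedVector : SeaweedIndex b S T → L)) := by
        rw [Submodule.map_span, ← Set.range_comp]
        rfl
      rw [← hmap] at hx
      obtain ⟨y, hy, rfl⟩ := hx
      exact hy)

lemma coe_seaweedBasis (i : SeaweedIndex b S T) : (seaweedBasis b S T i : L) = seaweedVector i := by
  rw [seaweedBasis, Module.Basis.mk_apply]

variable (b S T) in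
lemma finrank_seaweed : finrank K (seaweed b S T) =
    finrank K H + ((b.posRoots S).ncard + (b.posRoots T).ncard) := by
  rw [finrank_eq_card_basis (seaweedBasis b S T), Fintype.card_sum, Fintype.card_sum,
    Fintype.card_fin, ← Nat.card_eq_fintype_card, ← Nat.card_eq_fintype_card,
    Nat.card_coe_set_eq, Nat.card_coe_set_eq]

end SeaweedBasis

end LieAlgebra

namespace LieAlgebra

open LieAlgebra.IsKilling LieModule

/-! ### The degeneration and the kernel of its limit. -/

section Degeneration

variable {K L : Type*} [Field K] [CharZero K] [IsAlgClosed K] [LieRing L] [LieAlgebra K L]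
  [FiniteDimensional K L] [LieAlgebra.IsSemisimple K L]
  {H : LieSubalgebra K L} [H.IsCartanSubalgebra]

variable {b : (rootSystem H).Base} {S T : Set b.support}

/-- The exponents used to rescale the basis of `𝔤_{S,T}`. -/
def seaweedScale : SeaweedIndex b S T → ℕ := Sum.elim (fun _ ↦ 0) SeaweedRoot.scale

/-- The value at `⁅e_j, e_i⁆` of the form attached to `γ`. -/
def structureConst (γ : SeaweedRoot b S T) (i j : SeaweedIndex b S T) : K :=
  rootForm γ.weight ⁅seaweedVector j, seaweedVector i⁆

lemma weight_add_of_structureConst_ne_zero {γ : SeaweedRoot b S T} {i j : SeaweedIndex b S T}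
    (h : structureConst γ i j ≠ 0) : seaweedWeight j + seaweedWeight i = γ.weight := by
  by_contra hne
  exact h (rootForm_eq_zero_of_mem (lie_mem_genWeightSpace_of_mem_genWeightSpace
    (seaweedVector_mem_rootSpace j) (seaweedVector_mem_rootSpace i)) hne)

lemma structureConst_inl_inl (γ : SeaweedRoot b S T) (h h' : Fin (finrank K H)) :
    structureConst γ (Sum.inl h) (Sum.inl h') = 0 :=
  rootForm_coe γ ⁅finBasis K H h', finBasis K H h⁆

lemma eq_of_structureConst_inl_ne_zero {γ : SeaweedRoot b S T} {h : Fin (finrank K H)}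
    {i : SeaweedRoot b S T} (hne : structureConst γ (Sum.inl h) (Sum.inr i) ≠ 0) : i = γ := by
  have := weight_add_of_structureConst_ne_zero hne
  refine SeaweedRoot.weight_injective (DFunLike.coe_injective ?_)
  rw [← this]
  exact (add_zero _).symm

lemma eq_of_structureConst_inr_ne_zero {γ : SeaweedRoot b S T} {h : Fin (finrank K H)}
    {i : SeaweedRoot b S T} (hne : structureConst γ (Sum.inr i) (Sum.inl h) ≠ 0) : i = γ := by
  have := weight_add_of_structureConst_ne_zero hne
  refine SeaweedRoot.weight_injective (DFunLike.coe_injective ?_)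
  rw [← this]
  exact (zero_add _).symm

lemma linear_add_of_structureConst_ne_zero {γ i j : SeaweedRoot b S T}
    (hne : structureConst γ (Sum.inr i) (Sum.inr j) ≠ 0) : i.linear + j.linear = γ.linear := by
  rw [add_comm]
  exact SeaweedRoot.linear_eq_of_coe_eq (weight_add_of_structureConst_ne_zero hne)

lemma structureConst_inr_inl (γ : SeaweedRoot b S T) (h : Fin (finrank K H)) :
    structureConst γ (Sum.inr γ) (Sum.inl h) =
      γ.linear (finBasis K H h) * rootForm γ.weight (rootVector γ.weight) := by
  have h1 := lie_eq_smul_of_mem_rootSpace (rootVector_mem γ.weight) (finBasis K H h)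
  have h2 : structureConst γ (Sum.inr γ) (Sum.inl h) =
    rootForm γ.weight ⁅finBasis K H h, rootVector γ.weight⁆ := rfl
  rw [h2, h1, map_smul, smul_eq_mul, γ.coe_linear]

lemma structureConst_swap (γ : SeaweedRoot b S T) (i j : SeaweedIndex b S T) :
    structureConst γ i j = -structureConst γ j i := by
  rw [structureConst, structureConst, ← map_neg, lie_skew]

/-- This makes the natural-number subtraction in the exponents of `degeneration` a true one wherever
the coefficient is non-zero. -/
lemma two_mul_size_le_of_structureConst_ne_zero {γ : SeaweedRoot b S T} (hγ : γ.IsTop)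
    {i j : SeaweedIndex b S T} (hne : structureConst γ i j ≠ 0) :
    2 * γ.size ≤ seaweedScale i + seaweedScale j := by
  rcases i with h | i <;> rcases j with h' | j
  · exact (hne (structureConst_inl_inl γ h h')).elim
  · obtain rfl := eq_of_structureConst_inl_ne_zero hne
    change 2 * j.size ≤ 0 + j.scale
    rw [j.scale_of_isTop hγ, zero_add]
  · obtain rfl := eq_of_structureConst_inr_ne_zero hne
    change 2 * i.size ≤ i.scale + 0
    rw [i.scale_of_isTop hγ, add_zero]
  · change 2 * γ.size ≤ i.scale + j.scale
    rcases SeaweedRoot.two_mul_size_lt_or_top_eq hγ (linear_add_of_structureConst_ne_zero hne) with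
      h | ⟨hi, hj⟩
    · exact h.le
    · have h1 := i.size_top_le_scale
      have h2 := j.size_top_le_scale
      rw [hi] at h1
      rw [hj] at h2
      omega

variable (b S T) in
open Polynomial Classical in
/-- The matrices of the forms `Φ_f` of a family of linear forms `f` on `𝔤_{S,T}`, in rescaled
bases. -/
def degeneration : Matrix (SeaweedIndex b S T) (SeaweedIndex b S T) K[X] :=
  Matrix.of fun i j ↦ ∑ γ : SeaweedRoot b S T with γ.IsTop,
    C (structureConst γ i j) * X ^ (seaweedScale i + seaweedScale j - 2 * γ.size)

open Classical in
lemma degeneration_map_eval_apply (t : K) (i j : SeaweedIndex b S T) :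
    (degeneration b S T).map (Polynomial.eval t) i j =
      ∑ γ : SeaweedRoot b S T with γ.IsTop,
        structureConst γ i j * t ^ (seaweedScale i + seaweedScale j - 2 * γ.size) := by
  simp [degeneration, Polynomial.eval_finsetSum]

variable (b S T) in
open Classical in
/-- A family of linear forms on `𝔤_{S,T}`. -/
def topForm (t : K) : Dual K (seaweed b S T) :=
  ∑ γ : SeaweedRoot b S T with γ.IsTop,
    (t⁻¹ ^ (2 * γ.size)) • rootForm γ.weight ∘ₗ (seaweed b S T).toSubmodule.subtype

lemma degeneration_eval_of_ne_zero {t : K} (ht : t ≠ 0) (i j : SeaweedIndex b S T) :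
    (degeneration b S T).map (Polynomial.eval t) i j = t ^ seaweedScale i *
      (kirillovForm (topForm b S T t) (seaweedBasis b S T j) (seaweedBasis b S T i) *
        t ^ seaweedScale j) := by
  classical
  have h1 : kirillovForm (topForm b S T t) (seaweedBasis b S T j) (seaweedBasis b S T i) =
      ∑ γ : SeaweedRoot b S T with γ.IsTop, t⁻¹ ^ (2 * γ.size) * structureConst γ i j := by
    rw [kirillovForm_apply, topForm, LinearMap.sum_apply]
    refine Finset.sum_congr rfl fun γ _ ↦ ?_
    rw [LinearMap.smul_apply, LinearMap.comp_apply, smul_eq_mul, structureConst,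
      ← coe_seaweedBasis, ← coe_seaweedBasis]
    rfl
  rw [degeneration_map_eval_apply, h1, Finset.sum_mul, Finset.mul_sum]
  refine Finset.sum_congr rfl fun γ hγ ↦ ?_
  by_cases hne : structureConst γ i j = 0
  · simp [hne]
  · have hle := two_mul_size_le_of_structureConst_ne_zero (Finset.mem_filter.mp hγ).2 hne
    have : t ^ (seaweedScale i + seaweedScale j - 2 * γ.size) =
        t ^ seaweedScale i * t ^ seaweedScale j * t⁻¹ ^ (2 * γ.size) := by
      rw [pow_sub₀ t ht hle, pow_add, inv_pow]
    rw [this]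
    ring

/-- For `t ≠ 0` the matrix is `D Φ D` with `D` diagonal and invertible, so applying `D⁻¹` to
coordinates maps one kernel injectively into the other. -/
lemma finrank_ker_kirillovForm_le {t : K} (ht : t ≠ 0) :
    finrank K (LinearMap.ker (kirillovForm (topForm b S T t))) ≤
      finrank K (LinearMap.ker ((degeneration b S T).map (Polynomial.eval t)).mulVecLin) := by
  let F : seaweed b S T →ₗ[K] (SeaweedIndex b S T → K) :=
    LinearMap.pi fun i ↦ (t⁻¹ ^ seaweedScale i) • (seaweedBasis b S T).coord i
  have hF : Function.Injective F := by
    rw [← LinearMap.ker_eq_bot, LinearMap.ker_eq_bot']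
    intro x hx
    refine (seaweedBasis b S T).ext_elem fun i ↦ ?_
    have h1 : t⁻¹ ^ seaweedScale i * (seaweedBasis b S T).repr x i = 0 := congrFun hx i
    rw [map_zero]
    exact (mul_eq_zero.mp h1).resolve_left (pow_ne_zero _ (inv_ne_zero ht))
  have hmaps : ∀ x ∈ LinearMap.ker (kirillovForm (topForm b S T t)),
      F x ∈ LinearMap.ker ((degeneration b S T).map (Polynomial.eval t)).mulVecLin := by
    intro x hx
    rw [LinearMap.mem_ker, Matrix.mulVecLin_apply]
    ext i
    have h1 : kirillovForm (topForm b S T t) x (seaweedBasis b S T i) = 0 := by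
      rw [LinearMap.mem_ker.mp hx, LinearMap.zero_apply]
    rw [← (seaweedBasis b S T).sum_repr x, map_sum, LinearMap.sum_apply] at h1
    rw [Matrix.mulVec, dotProduct, Pi.zero_apply,
      ← mul_zero (t ^ seaweedScale i), ← h1, Finset.mul_sum]
    refine Finset.sum_congr rfl fun j _ ↦ ?_
    rw [degeneration_eval_of_ne_zero ht, map_smul, LinearMap.smul_apply, smul_eq_mul]
    have h2 : F x j = t⁻¹ ^ seaweedScale j * (seaweedBasis b S T).repr x j := rfl
    rw [h2, inv_pow]
    have h3 : t ^ seaweedScale j ≠ 0 := pow_ne_zero _ ht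
    field_simp
  exact LinearMap.finrank_le_finrank_of_injective (f := F.restrict hmaps)
    fun x y h ↦ Subtype.ext (hF (congrArg Subtype.val h))

/-- The matrix at `t = 0` of the degeneration. -/
def degenerateMatrix (b : (rootSystem H).Base) (S T : Set b.support) :
    Matrix (SeaweedIndex b S T) (SeaweedIndex b S T) K :=
  (degeneration b S T).map (Polynomial.eval 0)

lemma degenerateMatrix_eq_zero_of_forall {i j : SeaweedIndex b S T}
    (h : ∀ γ : SeaweedRoot b S T, γ.IsTop → structureConst γ i j ≠ 0 →
      2 * γ.size < seaweedScale i + seaweedScale j) : degenerateMatrix b S T i j = 0 := by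
  classical
  rw [degenerateMatrix, degeneration_map_eval_apply]
  refine Finset.sum_eq_zero fun γ hγ ↦ ?_
  by_cases hne : structureConst γ i j = 0
  · rw [hne, zero_mul]
  · have := h γ (Finset.mem_filter.mp hγ).2 hne
    rw [zero_pow (by omega), mul_zero]

lemma degenerateMatrix_eq {i j : SeaweedIndex b S T} {γ : SeaweedRoot b S T} (hγ : γ.IsTop)
    (hscale : seaweedScale i + seaweedScale j = 2 * γ.size)
    (h : ∀ γ' : SeaweedRoot b S T, structureConst γ' i j ≠ 0 → γ' = γ) :
    degenerateMatrix b S T i j = structureConst γ i j := by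
  classical
  rw [degenerateMatrix, degeneration_map_eval_apply, Finset.sum_eq_single γ]
  · rw [hscale, Nat.sub_self, pow_zero, mul_one]
  · intro γ' _ hne
    rw [not_imp_comm.mp (h γ') hne, zero_mul]
  · intro hγ'
    exact (hγ' (Finset.mem_filter.mpr ⟨Finset.mem_univ _, hγ⟩)).elim

lemma degenerateMatrix_inl_inl (h h' : Fin (finrank K H)) :
    degenerateMatrix b S T (Sum.inl h) (Sum.inl h') = 0 :=
  degenerateMatrix_eq_zero_of_forall fun γ _ hne ↦ (hne (structureConst_inl_inl γ h h')).elim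

lemma degenerateMatrix_inr_inl {γ : SeaweedRoot b S T} (hγ : γ.IsTop) (h : Fin (finrank K H)) :
    degenerateMatrix b S T (Sum.inr γ) (Sum.inl h) =
      γ.linear (finBasis K H h) * rootForm γ.weight (rootVector γ.weight) := by
  rw [degenerateMatrix_eq (i := Sum.inr γ) (j := Sum.inl h) hγ (γ.scale_of_isTop hγ)
    fun γ' h ↦ (eq_of_structureConst_inr_ne_zero h).symm, structureConst_inr_inl]

lemma degenerateMatrix_inl_inr {γ : SeaweedRoot b S T} (hγ : γ.IsTop) (h : Fin (finrank K H)) :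
    degenerateMatrix b S T (Sum.inl h) (Sum.inr γ) =
      -(γ.linear (finBasis K H h) * rootForm γ.weight (rootVector γ.weight)) := by
  rw [degenerateMatrix_eq (i := Sum.inl h) (j := Sum.inr γ) hγ ((zero_add _).trans (γ.scale_of_isTop hγ))
    fun γ' h ↦ (eq_of_structureConst_inl_ne_zero h).symm, structureConst_swap,
    structureConst_inr_inl]

lemma degenerateMatrix_inr_inl_of_not_isTop {i : SeaweedRoot b S T} (hi : ¬ i.IsTop)
    (h : Fin (finrank K H)) : degenerateMatrix b S T (Sum.inr i) (Sum.inl h) = 0 :=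
  degenerateMatrix_eq_zero_of_forall fun _ hγ hne ↦
    (hi (eq_of_structureConst_inr_ne_zero hne ▸ hγ)).elim

/-- A root has at most one partner with a surviving entry. Tops have none: in a class, the other
summand of a top would have to be zero. -/
lemma exists_of_degenerateMatrix_inr_inr_ne_zero {i j : SeaweedRoot b S T}
    (hne : degenerateMatrix b S T (Sum.inr i) (Sum.inr j) ≠ 0) :
    i.linear + j.linear = i.top.linear ∧ ¬ i.IsTop ∧ ¬ j.IsTop := by
  contrapose! hne
  refine degenerateMatrix_eq_zero_of_forall fun γ hγ hc ↦ ?_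
  have hadd := linear_add_of_structureConst_ne_zero hc
  refine (SeaweedRoot.two_mul_size_lt_or_top_eq hγ hadd).resolve_right fun ⟨hi, hj⟩ ↦ ?_
  exact SeaweedRoot.not_isTop_of_add_eq ((add_comm _ _).trans hadd) hj
    (hne (hi.symm ▸ hadd) (SeaweedRoot.not_isTop_of_add_eq hadd hi))

lemma degenerateMatrix_inr_inr_ne_zero {i j : SeaweedRoot b S T} (hi : ¬ i.IsTop) (hj : ¬ j.IsTop)
    (htop : j.top = i.top) (hadd : i.linear + j.linear = i.top.linear)
    (hne : rootForm i.top.weight ⁅rootVector i.weight, rootVector j.weight⁆ ≠ 0) :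
    degenerateMatrix b S T (Sum.inr j) (Sum.inr i) ≠ 0 := by
  rw [degenerateMatrix_eq (γ := i.top) i.isTop_top]
  · exact hne
  · change j.scale + i.scale = 2 * i.top.size
    rw [j.scale_of_not_isTop hj, i.scale_of_not_isTop hi, htop, two_mul]
  · intro γ' h
    refine SeaweedRoot.linear_injective ?_
    rw [← linear_add_of_structureConst_ne_zero h, ← hadd, add_comm]

section Kernel

variable {v : SeaweedIndex b S T → K}

lemma sum_add_sum_eq_zero_of_mem_ker
    (hv : v ∈ LinearMap.ker (degenerateMatrix b S T).mulVecLin) (i : SeaweedIndex b S T) :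
    ∑ h, degenerateMatrix b S T i (Sum.inl h) * v (Sum.inl h) +
      ∑ k, degenerateMatrix b S T i (Sum.inr k) * v (Sum.inr k) = 0 := by
  rw [← Fintype.sum_sum_type (fun j ↦ degenerateMatrix b S T i j * v j)]
  exact congrFun (LinearMap.mem_ker.mp hv) i

lemma apply_inr_eq_zero_of_mem_ker (hv : v ∈ LinearMap.ker (degenerateMatrix b S T).mulVecLin)
    {i : SeaweedRoot b S T} (hi : ¬ i.IsTop) : v (Sum.inr i) = 0 := by
  obtain ⟨j, hj, htop, hadd, hne⟩ := SeaweedRoot.exists_partner hi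
  -- The row of the partner `j` has its only non-zero entry in column `i`.
  have h := sum_add_sum_eq_zero_of_mem_ker hv (Sum.inr j)
  rw [Finset.sum_eq_zero, zero_add, Finset.sum_eq_single i] at h
  · exact (mul_eq_zero.mp h).resolve_left
      (degenerateMatrix_inr_inr_ne_zero hi hj htop hadd hne)
  · intro k _ hk
    by_cases hjk : degenerateMatrix b S T (Sum.inr j) (Sum.inr k) = 0
    · rw [hjk, zero_mul]
    · refine (hk (SeaweedRoot.linear_injective ?_)).elim
      have := (exists_of_degenerateMatrix_inr_inr_ne_zero hjk).1
      rw [htop, ← hadd, add_comm] at this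
      exact add_right_cancel this
  · simp
  · intro h _
    rw [degenerateMatrix_inr_inl_of_not_isTop hj, zero_mul]

lemma linear_sum_eq_zero_of_mem_ker (hv : v ∈ LinearMap.ker (degenerateMatrix b S T).mulVecLin)
    {γ : SeaweedRoot b S T} (hγ : γ.IsTop) :
    γ.linear (∑ h, v (Sum.inl h) • finBasis K H h) = 0 := by
  have h := sum_add_sum_eq_zero_of_mem_ker hv (Sum.inr γ)
  rw [Finset.sum_eq_zero (s := Finset.univ (α := SeaweedRoot b S T)), add_zero] at h
  · refine (mul_eq_zero.mp (Eq.trans ?_ h)).resolve_right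
      (rootForm_rootVector_ne_zero γ.weight_isNonZero)
    rw [map_sum, Finset.sum_mul]
    refine Finset.sum_congr rfl fun h _ ↦ ?_
    rw [degenerateMatrix_inr_inl hγ, map_smul, smul_eq_mul]
    ring
  · intro k _
    by_cases hk : degenerateMatrix b S T (Sum.inr γ) (Sum.inr k) = 0
    · rw [hk, zero_mul]
    · exact ((exists_of_degenerateMatrix_inr_inr_ne_zero hk).2.1 hγ).elim

open Classical in
lemma sum_smul_linear_eq_zero_of_mem_ker
    (hv : v ∈ LinearMap.ker (degenerateMatrix b S T).mulVecLin) :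
    ∑ γ : {γ : SeaweedRoot b S T // γ.IsTop}, (v (Sum.inr γ.1) *
      rootForm γ.1.weight (rootVector γ.1.weight)) • γ.1.linear = 0 := by
  refine (finBasis K H).ext fun h ↦ ?_
  -- The rows indexed by `𝔥` state, coordinate by coordinate, a linear relation among the tops.
  have h0 := sum_add_sum_eq_zero_of_mem_ker hv (Sum.inl h)
  rw [Finset.sum_eq_zero (s := Finset.univ (α := Fin (finrank K H))), zero_add] at h0
  · rw [LinearMap.sum_apply, LinearMap.zero_apply, ← neg_zero, ← h0, ← Finset.sum_neg_distrib,
      ← Finset.sum_subset (Finset.subset_univ (Finset.univ.filter SeaweedRoot.IsTop))]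
    · rw [← Finset.sum_subtype_eq_sum_filter, Finset.subtype_univ]
      refine Finset.sum_congr rfl fun γ _ ↦ ?_
      rw [degenerateMatrix_inl_inr γ.2, LinearMap.smul_apply, smul_eq_mul]
      ring
    · intro k _ hk
      have hk' : ¬ k.IsTop := fun h ↦ hk (Finset.mem_filter.mpr ⟨Finset.mem_univ _, h⟩)
      rw [apply_inr_eq_zero_of_mem_ker hv hk', mul_zero, neg_zero]
  · intro h' _
    rw [degenerateMatrix_inl_inl, zero_mul]

end Kernel

end Degeneration

end LieAlgebra

namespace LieAlgebra

open LieAlgebra.IsKilling LieModule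

/-! ### The upper bound and the parity of the index. -/

section Index

variable {K L : Type*} [Field K] [CharZero K] [IsAlgClosed K] [LieRing L] [LieAlgebra K L]
  [FiniteDimensional K L] [LieAlgebra.IsSemisimple K L]
  {H : LieSubalgebra K L} [H.IsCartanSubalgebra]
  (b : (rootSystem H).Base) (S T : Set b.support)

lemma span_linear_isTop :
    Submodule.span K (Set.range fun γ : {γ : SeaweedRoot b S T // γ.IsTop} ↦ γ.1.linear) =
      b.cascadeSpan S T := by
  rw [b.cascadeSpan_eq]
  refine le_antisymm (Submodule.span_le.mpr ?_) (Submodule.span_le.mpr ?_)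
  · rintro - ⟨⟨γ | γ, hγ⟩, rfl⟩
    · exact Submodule.subset_span ⟨γ.1, Or.inl hγ, rfl⟩
    · exact neg_mem (Submodule.subset_span ⟨γ.1, Or.inr hγ, rfl⟩)
  · rintro - ⟨γ, hγ | hγ, rfl⟩
    · exact Submodule.subset_span ⟨⟨Sum.inl ⟨γ, b.cascadeRoots_subset S hγ⟩, hγ⟩, rfl⟩
    · rw [SetLike.mem_coe, ← neg_mem_iff]
      exact Submodule.subset_span ⟨⟨Sum.inr ⟨γ, b.cascadeRoots_subset T hγ⟩, hγ⟩, rfl⟩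

lemma natCard_isTop : Nat.card {γ : SeaweedRoot b S T // γ.IsTop} =
    (b.cascade S).ncard + (b.cascade T).ncard := by
  have e : {γ : SeaweedRoot b S T // γ.IsTop} ≃ b.cascadeRoots S ⊕ b.cascadeRoots T :=
    { toFun := fun
        | ⟨Sum.inl γ, hγ⟩ => Sum.inl ⟨γ.1, hγ⟩
        | ⟨Sum.inr γ, hγ⟩ => Sum.inr ⟨γ.1, hγ⟩
      invFun := fun
        | Sum.inl γ => ⟨Sum.inl ⟨γ.1, b.cascadeRoots_subset S γ.2⟩, γ.2⟩
        | Sum.inr γ => ⟨Sum.inr ⟨γ.1, b.cascadeRoots_subset T γ.2⟩, γ.2⟩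
      left_inv := by rintro ⟨γ | γ, hγ⟩ <;> rfl
      right_inv := by rintro (γ | γ) <;> rfl }
  rw [Nat.card_congr e, Nat.card_sum, Nat.card_coe_set_eq, Nat.card_coe_set_eq,
    b.ncard_cascadeRoots, b.ncard_cascadeRoots]

/-- A kernel vector vanishes on roots that are not tops. Its `𝔥`-part is annihilated by `E`, and its
top coordinates, scaled by the non-zero `c γ`, form a linear relation among the tops; rank-nullity
counts both spaces. A root occurring in both cascades gives two tops of opposite sign, hence the sum
of the two cardinalities. -/
lemma finrank_ker_degenerateMatrix_le :
    finrank K (LinearMap.ker (degenerateMatrix b S T).mulVecLin) +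
      2 * finrank K (b.cascadeSpan S T) ≤
      finrank K H + ((b.cascade S).ncard + (b.cascade T).ncard) := by
  classical
  let D := {γ : SeaweedRoot b S T // γ.IsTop}
  let E := b.cascadeSpan S T
  let F : (D → K) →ₗ[K] Dual K H := Fintype.linearCombination K fun γ : D ↦ γ.1.linear
  have hF : LinearMap.range F = E :=
    (Fintype.range_linearCombination K _).trans (span_linear_isTop b S T)
  have hFker : finrank K E + finrank K (LinearMap.ker F) =
      (b.cascade S).ncard + (b.cascade T).ncard := by
    rw [← hF, F.finrank_range_add_finrank_ker, finrank_fintype_fun_eq_card,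
      ← Nat.card_eq_fintype_card, natCard_isTop]
  have hE : finrank K E + finrank K E.dualCoannihilator = finrank K H :=
    Subspace.finrank_add_finrank_dualCoannihilator_eq E
  let c : D → K := fun γ ↦ rootForm γ.1.weight (rootVector γ.1.weight)
  let G₁ : (SeaweedIndex b S T → K) →ₗ[K] H :=
    (finBasis K H).equivFun.symm.toLinearMap ∘ₗ LinearMap.funLeft K K Sum.inl
  let G₂ : (SeaweedIndex b S T → K) →ₗ[K] (D → K) :=
    LinearMap.pi fun γ ↦ c γ • LinearMap.proj (Sum.inr γ.1)
  have h₁ : ∀ v ∈ LinearMap.ker (degenerateMatrix b S T).mulVecLin,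
      G₁ v ∈ E.dualCoannihilator := by
    intro v hv
    have hval : G₁ v = ∑ h, v (Sum.inl h) • finBasis K H h := (finBasis K H).equivFun_symm_apply _
    rw [Submodule.mem_dualCoannihilator]
    intro φ hφ
    have hle : E ≤ LinearMap.ker (Dual.eval K H (G₁ v)) := by
      refine (span_linear_isTop b S T).symm.le.trans (Submodule.span_le.mpr ?_)
      rintro - ⟨γ, rfl⟩
      rw [SetLike.mem_coe, LinearMap.mem_ker, Dual.eval_apply, hval]
      exact linear_sum_eq_zero_of_mem_ker hv γ.2
    exact hle hφ
  have h₂ : ∀ v ∈ LinearMap.ker (degenerateMatrix b S T).mulVecLin, G₂ v ∈ LinearMap.ker F := by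
    intro v hv
    rw [LinearMap.mem_ker, ← sum_smul_linear_eq_zero_of_mem_ker hv]
    refine (Fintype.linearCombination_apply K _ _).trans ?_
    refine Finset.sum_congr (by congr!) fun γ _ ↦ ?_
    congr 1
    exact mul_comm _ _
  have hinj : Function.Injective ((G₁.restrict h₁).prod (G₂.restrict h₂)) := by
    rw [← LinearMap.ker_eq_bot, LinearMap.ker_eq_bot']
    rintro ⟨v, hv⟩ h
    have e₁ : G₁ v = 0 := congrArg Subtype.val (congrArg Prod.fst h)
    have e₂ : G₂ v = 0 := congrArg Subtype.val (congrArg Prod.snd h)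
    refine Subtype.ext (funext ?_)
    rintro (k | k)
    · exact congrFun ((finBasis K H).equivFun.symm.map_eq_zero_iff.mp e₁) k
    · by_cases hk : k.IsTop
      · have : c ⟨k, hk⟩ * v (Sum.inr k) = 0 := congrFun e₂ ⟨k, hk⟩
        exact (mul_eq_zero.mp this).resolve_left (rootForm_rootVector_ne_zero k.weight_isNonZero)
      · exact apply_inr_eq_zero_of_mem_ker hv hk
  have hle := LinearMap.finrank_le_finrank_of_injective hinj
  rw [Module.finrank_prod] at hle
  change _ + 2 * finrank K E ≤ _
  omega

lemma index_seaweed_le : (index K (seaweed b S T) : ℤ) ≤ seaweedBound b S T := by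
  obtain ⟨t, ht, hle⟩ := Matrix.exists_ne_zero_finrank_ker_le (degeneration b S T)
  have h1 := index_le (topForm b S T t)
  have h2 := finrank_ker_kirillovForm_le (b := b) (S := S) (T := T) ht
  have h3 := finrank_ker_degenerateMatrix_le b S T
  have h4 : finrank K (LinearMap.ker ((degeneration b S T).map (Polynomial.eval 0)).mulVecLin) =
    finrank K (LinearMap.ker (degenerateMatrix b S T).mulVecLin) := rfl
  rw [seaweedBound]
  omega

lemma index_seaweed_modEq : (index K (seaweed b S T) : ℤ) ≡ seaweedBound b S T [ZMOD 2] := by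
  have h1 := finrank_modEq_index K (seaweed b S T)
  rw [finrank_seaweed] at h1
  have h2 := b.ncard_posRoots_modEq S
  have h3 := b.ncard_posRoots_modEq T
  rw [seaweedBound]
  unfold Nat.ModEq at h1 h2 h3
  unfold Int.ModEq
  omega

end Index

end LieAlgebra

end

theorem proposition4p2 {K L : Type*} [Field K] [CharZero K] [IsAlgClosed K]
    [LieRing L] [LieAlgebra K L] [FiniteDimensional K L] [LieAlgebra.IsSemisimple K L]
    (H : LieSubalgebra K L) [H.IsCartanSubalgebra]
    (b : (LieAlgebra.IsKilling.rootSystem H).Base) (S T : Set b.support)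
    (hd : LieAlgebra.seaweedBound b S T = 0 ∨ LieAlgebra.seaweedBound b S T = 1) :
    (LieAlgebra.index K (LieAlgebra.seaweed b S T) : ℤ) = LieAlgebra.seaweedBound b S T := by
  have hle := LieAlgebra.index_seaweed_le b S T
  have hmod := LieAlgebra.index_seaweed_modEq b S T
  unfold Int.ModEq at hmod
  -- The index is non-negative, so the bound by 0 or 1 and the parity leave a single value.
  omega
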